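/- Let $\Omega\subset\mathbb C$ be a Borel set, let $\lambda$ be Lebesgue measure, and let $\mathcal B$ and $\mathcal K$ be the algebras of bounded and of compact operators on the complex Hilbert space $L^2(\Omega,\lambda)$. Denote by $\|\cdot\|$ the operator norm and by $|\cdot|_2$ the Hilbert--Schmidt norm (with value $+\infty$ for operators that are not Hilbert--Schmidt). For $f\in L^\infty(\Omega,\lambda)$ let $M_f$ be the operator of multiplication by $f$ on $L^2(\Omega,\lambda)$ and let $Df(s,t)=\frac{f(s)-f(t)}{s-t}$ for $s\neq t$. Let $\Lambda(\Omega)$ be the set of all $f\in L^\infty(\Omega,\lambda)$ with $Df\in L^\infty(\Omega\times\Omega,\lambda\otimes\lambda)$. For $T\in\mathcal B$ put $$L(T)=\sup\{|[M_f,T]|_2 : f\in\Lambda(\Omega),\ \|Df\|_\infty\le 1\}.$$ Let $E\Lambda(\Omega)=\{T\in\mathcal B : L(T)<\infty\}$, a $*$-subalgebra of $\mathcal B$, with the norm $|||T|||=\|T\|+L(T)$ and the involution of $\mathcal B$, and let $\mathcal K\Lambda(\Omega)=E\Lambda(\Omega)\cap\mathcal K$, a closed two-sided $*$-ideal of $E\Lambda(\Omega)$.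 Let $(E/\mathcal K)\Lambda(\Omega)=E\Lambda(\Omega)/\mathcal K\Lambda(\Omega)$, with the quotient norm and the quotient involution, and let $p:E\Lambda(\Omega)\to(E/\mathcal K)\Lambda(\Omega)$ be the canonical surjection. Then: 1. $(E/\mathcal K)\Lambda(\Omega)$ is a $C^*$-algebra, i.e. it is complete and $\|a^*a\|=\|a\|^2$ for all $a$. 2. For every $x\in E\Lambda(\Omega)$ the norm of $p(x)$ in $(E/\mathcal K)\Lambda(\Omega)$ equals the norm of $x+\mathcal K$ in the Calkin algebra $\mathcal B/\mathcal K$. 3. The map $p(x)\mapsto x+\mathcal K$ is a well-defined isometric $*$-isomorphism of $(E/\mathcal K)\Lambda(\Omega)$ onto a $C^*$-subalgebra (a norm-closed $*$-subalgebra) of $\mathcal B/\mathcal K$. -/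

import Mathlib

open MeasureTheory
open scoped ENNReal

noncomputable section

namespace ELam

/-! ### Hilbert--Schmidt norm -/

section HilbertSchmidt

variable {H : Type*} [NormedAddCommGroup H] [InnerProductSpace ℂ H]

lemma enorm_sq_eq_tsum {ι : Type*} (b : HilbertBasis ι ℂ H) (x : H) :
    ‖x‖ₑ ^ (2 : ℝ) = ∑' i, ‖inner ℂ (b i) x‖ₑ ^ (2 : ℝ) := by
  have h := b.hasSum_inner_mul_inner x x
  have h2 : HasSum (fun i => ‖inner ℂ (b i) x‖ ^ 2) (‖x‖ ^ 2) := by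
    have h3 := Complex.hasSum_re h
    convert h3 using 1
    · funext i
      rw [← inner_conj_symm x (b i), mul_comm, RCLike.mul_conj]
      norm_cast
    · rw [inner_self_eq_norm_sq_to_K]
      norm_cast
  have h4 : ∀ y : ℝ, 0 ≤ y → ENNReal.ofReal (y ^ 2) = (ENNReal.ofReal y) ^ (2 : ℝ) := by
    intro y hy
    rw [ENNReal.ofReal_pow hy]; norm_cast
  have h5 := ENNReal.ofReal_tsum_of_nonneg (fun i => sq_nonneg ‖inner ℂ (b i) x‖) h2.summable
  rw [h2.tsum_eq, h4 _ (norm_nonneg _)] at h5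
  simp only [h4 _ (norm_nonneg _), ofReal_norm] at h5
  exact h5

variable [CompleteSpace H]

variable (H) in
/-- The index set of a chosen Hilbert basis of `H`. -/
def basisIndex : Set H := (exists_hilbertBasis ℂ H).choose

variable (H) in
/-- A chosen Hilbert basis of `H`. -/
def stdBasis : HilbertBasis (basisIndex H) ℂ H := (exists_hilbertBasis ℂ H).choose_spec.choose

/-- The Hilbert--Schmidt norm `|T|₂ = (Tr T*T)^(1/2) = (∑ᵢ ‖T eᵢ‖²)^(1/2)`, with values in
`[0, ∞]`; by `hsNorm_eq` it does not depend on the Hilbert basis `(eᵢ)`. -/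
def hsNorm (T : H →L[ℂ] H) : ℝ≥0∞ := (∑' i, ‖T (stdBasis H i)‖ₑ ^ (2 : ℝ)) ^ (1 / 2 : ℝ)

lemma tsum_adjoint {ι κ : Type*} (b : HilbertBasis ι ℂ H) (c : HilbertBasis κ ℂ H)
    (T : H →L[ℂ] H) :
    ∑' i, ‖T (b i)‖ₑ ^ (2 : ℝ) = ∑' j, ‖(star T) (c j)‖ₑ ^ (2 : ℝ) := by
  simp_rw [enorm_sq_eq_tsum c (T _), enorm_sq_eq_tsum b ((star T) _)]
  rw [ENNReal.tsum_comm]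
  refine tsum_congr fun j => tsum_congr fun i => ?_
  rw [ContinuousLinearMap.star_eq_adjoint, ContinuousLinearMap.adjoint_inner_right,
    ← inner_conj_symm (c j), RCLike.enorm_conj]

lemma hsNorm_eq {ι : Type*} (b : HilbertBasis ι ℂ H) (T : H →L[ℂ] H) :
    hsNorm T = (∑' i, ‖T (b i)‖ₑ ^ (2 : ℝ)) ^ (1 / 2 : ℝ) := by
  rw [hsNorm, tsum_adjoint (stdBasis H) (stdBasis H) T, ← tsum_adjoint b (stdBasis H) T]

lemma hsNorm_star (T : H →L[ℂ] H) : hsNorm (star T) = hsNorm T := by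
  rw [hsNorm, hsNorm, tsum_adjoint (stdBasis H) (stdBasis H) T]

lemma hsNorm_zero : hsNorm (0 : H →L[ℂ] H) = 0 := by
  simp [hsNorm]

lemma hsNorm_neg (T : H →L[ℂ] H) : hsNorm (-T) = hsNorm T := by
  simp [hsNorm]

lemma hsNorm_add_le (S T : H →L[ℂ] H) : hsNorm (S + T) ≤ hsNorm S + hsNorm T := by
  have key : ∀ s : Finset (basisIndex H),
      (∑ i ∈ s, ‖(S + T) (stdBasis H i)‖ₑ ^ (2 : ℝ)) ^ (1 / 2 : ℝ) ≤ hsNorm S + hsNorm T := by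
    intro s
    calc _ ≤ (∑ i ∈ s, (‖S (stdBasis H i)‖ₑ + ‖T (stdBasis H i)‖ₑ) ^ (2 : ℝ)) ^ (1 / 2 : ℝ) := by
          gcongr with i hi
          exact enorm_add_le _ _
      _ ≤ (∑ i ∈ s, ‖S (stdBasis H i)‖ₑ ^ (2 : ℝ)) ^ (1 / 2 : ℝ)
          + (∑ i ∈ s, ‖T (stdBasis H i)‖ₑ ^ (2 : ℝ)) ^ (1 / 2 : ℝ) :=
          ENNReal.Lp_add_le s _ _ (by norm_num)
      _ ≤ _ := by
          unfold hsNorm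
          gcongr <;> exact ENNReal.sum_le_tsum s
  have key2 : ∑' i, ‖(S + T) (stdBasis H i)‖ₑ ^ (2 : ℝ) ≤ (hsNorm S + hsNorm T) ^ (2 : ℝ) := by
    rw [ENNReal.tsum_eq_iSup_sum]
    refine iSup_le fun s => ?_
    have := ENNReal.rpow_le_rpow (key s) (by norm_num : (0 : ℝ) ≤ 2)
    rwa [← ENNReal.rpow_mul, one_div, inv_mul_cancel₀ (by norm_num), ENNReal.rpow_one] at this
  have := ENNReal.rpow_le_rpow key2 (by norm_num : (0 : ℝ) ≤ 1 / 2)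
  rwa [← ENNReal.rpow_mul, one_div, mul_inv_cancel₀ (by norm_num), ENNReal.rpow_one,
    ← one_div] at this

lemma hsNorm_mul_le_left (S T : H →L[ℂ] H) : hsNorm (S * T) ≤ ‖S‖ₑ * hsNorm T := by
  unfold hsNorm
  have : ∑' i, ‖(S * T) (stdBasis H i)‖ₑ ^ (2 : ℝ)
      ≤ ‖S‖ₑ ^ (2 : ℝ) * ∑' i, ‖T (stdBasis H i)‖ₑ ^ (2 : ℝ) := by
    rw [← ENNReal.tsum_mul_left]
    refine ENNReal.tsum_le_tsum fun i => ?_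
    rw [← ENNReal.mul_rpow_of_nonneg _ _ (by norm_num)]
    gcongr
    exact S.le_opENorm _
  refine (ENNReal.rpow_le_rpow this (by norm_num)).trans ?_
  rw [ENNReal.mul_rpow_of_nonneg _ _ (by norm_num), ← ENNReal.rpow_mul]
  norm_num

lemma hsNorm_mul_le_right (S T : H →L[ℂ] H) : hsNorm (S * T) ≤ hsNorm S * ‖T‖ₑ := by
  rw [← hsNorm_star, star_mul, mul_comm, ← hsNorm_star S]
  refine (hsNorm_mul_le_left _ _).trans ?_
  rw [← ofReal_norm, ← ofReal_norm, norm_star]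

lemma hsNorm_smul (c : ℂ) (T : H →L[ℂ] H) : hsNorm (c • T) = ‖c‖ₑ * hsNorm T := by
  unfold hsNorm
  simp_rw [smul_apply, enorm_smul,
    ENNReal.mul_rpow_of_nonneg _ _ (by norm_num : (0 : ℝ) ≤ 2), ENNReal.tsum_mul_left]
  rw [ENNReal.mul_rpow_of_nonneg _ _ (by norm_num), ← ENNReal.rpow_mul]
  norm_num

end HilbertSchmidt

/-! ### Quotients of normed `*`-rings by closed two-sided `*`-ideals -/

section Quotient

/-- A `*`-invariant ideal. -/
class IsStarIdeal {A : Type*} [Ring A] [StarRing A] (I : Ideal A) : Prop where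
  star_mem : ∀ {a : A}, a ∈ I → star a ∈ I

variable {A : Type*} [NormedRing A] (I : Ideal A) [I.IsTwoSided]

/-- The quotient by a closed two-sided ideal, with the quotient norm
`‖a + I‖ = inf {‖a + b‖ : b ∈ I}`. -/
instance quotientNormedRing [IsClosed (I : Set A)] : NormedRing (A ⧸ I) :=
  { Submodule.Quotient.normedAddCommGroup I, Ideal.Quotient.ring I with
    norm_mul_le := by
      intro x y
      have key : ∀ δ > 0, ‖x * y‖ ≤ (‖x‖ + δ) * (‖y‖ + δ) := by
        intro δ hδ
        obtain ⟨a, rfl, ha⟩ := Submodule.Quotient.norm_mk_lt x hδ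
        obtain ⟨b, rfl, hb⟩ := Submodule.Quotient.norm_mk_lt y hδ
        calc _ ≤ ‖a * b‖ := Submodule.Quotient.norm_mk_le I (a * b)
          _ ≤ ‖a‖ * ‖b‖ := norm_mul_le a b
          _ ≤ _ := by gcongr
      have hc : Filter.Tendsto (fun δ : ℝ => (‖x‖ + δ) * (‖y‖ + δ)) (nhdsWithin 0 (Set.Ioi 0))
          (nhds (‖x‖ * ‖y‖)) := by
        have : Continuous (fun δ : ℝ => (‖x‖ + δ) * (‖y‖ + δ)) := by fun_prop
        simpa using (this.tendsto 0).mono_left nhdsWithin_le_nhds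
      exact ge_of_tendsto hc (Filter.eventually_of_mem self_mem_nhdsWithin key) }

instance quotientNormedAlgebra [IsClosed (I : Set A)] [NormedAlgebra ℂ A] :
    NormedAlgebra ℂ (A ⧸ I) :=
  { Ideal.Quotient.algebra ℂ with
    norm_smul_le := (Submodule.Quotient.normedSpace I ℂ).norm_smul_le }

/-- The involution `(a + I)* = a* + I`. -/
instance quotientStarRing [StarRing A] [IsStarIdeal I] : StarRing (A ⧸ I) where
  star := Quotient.map' star fun a b h => by
    rw [Submodule.quotientRel_def] at h ⊢
    rw [← star_sub]
    exact IsStarIdeal.star_mem h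
  star_involutive := by
    rintro ⟨a⟩
    exact congrArg (Ideal.Quotient.mk I) (star_star a)
  star_mul := by
    rintro ⟨a⟩ ⟨b⟩
    exact congrArg (Ideal.Quotient.mk I) (star_mul a b)
  star_add := by
    rintro ⟨a⟩ ⟨b⟩
    exact congrArg (Ideal.Quotient.mk I) (star_add a b)

lemma star_mk [StarRing A] [IsStarIdeal I] (a : A) :
    star (Ideal.Quotient.mk I a) = Ideal.Quotient.mk I (star a) := rfl

instance quotientStarModule [IsClosed (I : Set A)] [NormedAlgebra ℂ A] [StarRing A]
    [StarModule ℂ A] [IsStarIdeal I] : StarModule ℂ (A ⧸ I) where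
  star_smul := by
    rintro c ⟨a⟩
    exact congrArg (Ideal.Quotient.mk I) (star_smul c a)

end Quotient

/-! ### The compact operators and the Calkin algebra -/

section Calkin

variable (H : Type*) [NormedAddCommGroup H] [InnerProductSpace ℂ H] [CompleteSpace H]

/-- The ideal `𝒦(H)` of compact operators in `ℬ(H)`. -/
def compactIdeal : Ideal (H →L[ℂ] H) where
  carrier := {T | IsCompactOperator T}
  add_mem' := fun hS hT => hS.add hT
  zero_mem' := isCompactOperator_zero
  smul_mem' := fun S _ hT => hT.clm_comp S

instance : (compactIdeal H).IsTwoSided where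
  mul_mem_of_left := fun {_} T hS => IsCompactOperator.comp_clm hS T

instance : IsClosed (compactIdeal H : Set (H →L[ℂ] H)) :=
  isClosed_setOfPred_isCompactOperator

variable {H} in
lemma isCompactOperator_star {T : H →L[ℂ] H} (hT : IsCompactOperator T) :
    IsCompactOperator (star T : H →L[ℂ] H) := by
  have hS : IsCompactOperator (T * star T : H →L[ℂ] H) := IsCompactOperator.comp_clm hT (star T)
  have hS' := hS.isCompact_closure_image_ball 1
  refine (isCompactOperator_iff_isCompact_closure_image_ball
    ((star T : H →L[ℂ] H) : H →ₗ[ℂ] H) one_pos).2 ?_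
  refine TotallyBounded.isCompact_of_isClosed ?_ isClosed_closure
  refine TotallyBounded.closure ?_
  have htb := hS'.totallyBounded.subset subset_closure
  refine Metric.totallyBounded_of_finite_discretization fun ε hε => ?_
  obtain ⟨t, ht, hcov⟩ := Metric.totallyBounded_iff.1 htb (ε ^ 2 / 4) (by positivity)
  have hx : ∀ y : (star T : H →L[ℂ] H) '' Metric.ball 0 1,
      ∃ x ∈ Metric.ball (0 : H) 1, star T x = y := fun y => y.2
  choose x hxb hxy using hx
  have hc : ∀ y, ∃ c : t, dist ((T * star T) (x y)) c < ε ^ 2 / 4 := by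
    intro y
    have := hcov (Set.mem_image_of_mem _ (hxb y))
    simp only [Set.mem_iUnion, Metric.mem_ball, exists_prop] at this
    obtain ⟨c, hc, h⟩ := this
    exact ⟨⟨c, hc⟩, h⟩
  choose F hF using hc
  refine ⟨t, ht.fintype, F, fun y z hyz => ?_⟩
  have h1 : ‖(T * star T) (x y - x z)‖ < ε ^ 2 / 2 := by
    rw [map_sub, ← dist_eq_norm]
    have h2 := hF z
    rw [← hyz, dist_comm] at h2
    have h3 := dist_triangle ((T * star T) (x y)) (F y) ((T * star T) (x z))
    linarith [hF y]
  have h2 : ‖x y - x z‖ ≤ 2 := by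
    have h3 := norm_sub_le (x y) (x z)
    have h4 := hxb y
    have h5 := hxb z
    rw [mem_ball_zero_iff] at h4 h5
    linarith
  have h3 : ‖star T (x y - x z)‖ ^ 2 ≤ ‖(T * star T) (x y - x z)‖ * ‖x y - x z‖ := by
    have h4 : (inner ℂ ((T * star T) (x y - x z)) (x y - x z) : ℂ)
        = inner ℂ (star T (x y - x z)) (star T (x y - x z)) := by
      rw [mul_apply_eq_comp, ContinuousLinearMap.star_eq_adjoint,
        ContinuousLinearMap.adjoint_inner_right]
    rw [← inner_self_eq_norm_sq (𝕜 := ℂ), ← h4]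
    exact (RCLike.re_le_norm _).trans (norm_inner_le_norm _ _)
  have h4 : ‖star T (x y - x z)‖ ^ 2 < ε ^ 2 := by
    have h5 : ‖(T * star T) (x y - x z)‖ * ‖x y - x z‖ ≤ ‖(T * star T) (x y - x z)‖ * 2 := by
      gcongr
    linarith
  have h5 : dist (y : H) (z : H) = ‖star T (x y - x z)‖ := by
    rw [map_sub, hxy, hxy]
    exact dist_eq_norm _ _
  exact h5.trans_lt (lt_of_pow_lt_pow_left₀ 2 hε.le h4)

instance : IsStarIdeal (compactIdeal H) where
  star_mem := fun h => isCompactOperator_star h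

/-- The Calkin algebra `ℬ(H)/𝒦(H)` with its quotient norm. -/
abbrev Calkin : Type _ := (H →L[ℂ] H) ⧸ compactIdeal H

end Calkin

/-! ### The algebras `EΛ(Ω)` and `𝒦Λ(Ω)` -/

section ELambda

variable (Ω : Set ℂ)

/-- Lebesgue measure on `Ω`. -/
abbrev leb : Measure ℂ := volume.restrict Ω

/-- The Hilbert space `L²(Ω, λ)`. -/
abbrev L2 : Type := Lp ℂ 2 (leb Ω)

/-- The space `L^∞(Ω, λ)`. -/
abbrev Linf : Type := Lp ℂ ∞ (leb Ω)

variable {Ω}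

/-- The multiplication operator `M_f` on `L²(Ω, λ)`, for `f ∈ L^∞(Ω, λ)`. -/
def mulOp (f : Linf Ω) : L2 Ω →L[ℂ] L2 Ω :=
  (ContinuousLinearMap.mul ℂ ℂ).holderL (leb Ω) ∞ 2 2 f

/-- The difference quotient `Df(s,t) = (f(s) - f(t)) / (s - t)`; its value on the diagonal, which
is a null set, does not matter. -/
def diffQuot (f : Linf Ω) (p : ℂ × ℂ) : ℂ := (f p.1 - f p.2) / (p.1 - p.2)

variable (Ω) in
/-- The set `Λ(Ω)` of essentially Lipschitz functions. -/
def lipSet : Set (Linf Ω) := {f | MemLp (diffQuot f) ∞ ((leb Ω).prod (leb Ω))}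

lemma mulOp_coeFn (f : Linf Ω) (g : L2 Ω) : mulOp f g =ᵐ[leb Ω] fun z => f z * g z :=
  ContinuousLinearMap.coeFn_holder (r := 2) (ContinuousLinearMap.mul ℂ ℂ) f g

lemma star_mulOp (f : Linf Ω) : star (mulOp f) = mulOp (star f) := by
  rw [ContinuousLinearMap.star_eq_adjoint, eq_comm, ContinuousLinearMap.eq_adjoint_iff]
  intro g h
  rw [L2.inner_def, L2.inner_def]
  refine integral_congr_ae ?_
  filter_upwards [mulOp_coeFn (star f) g, mulOp_coeFn f h, Lp.coeFn_star f] with z h1 h2 h3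
  rw [h1, h2, h3]
  simp
  ring

lemma aestronglyMeasurable_diffQuot (f : Linf Ω) :
    AEStronglyMeasurable (diffQuot f) ((leb Ω).prod (leb Ω)) := by
  have hf : Measurable f := (Lp.stronglyMeasurable f).measurable
  have : Measurable (diffQuot f) := by
    unfold diffQuot
    fun_prop
  exact this.aestronglyMeasurable

lemma norm_diffQuot_star (f : Linf Ω) :
    ∀ᵐ p ∂((leb Ω).prod (leb Ω)), ‖diffQuot (star f) p‖ = ‖diffQuot f p‖ := by
  filter_upwards [Measure.quasiMeasurePreserving_fst.ae (Lp.coeFn_star f),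
    Measure.quasiMeasurePreserving_snd.ae (Lp.coeFn_star f)] with p h1 h2
  rw [diffQuot, diffQuot, h1, h2, Pi.star_apply, Pi.star_apply, ← star_sub, norm_div, norm_div,
    norm_star]

variable (Ω) in
/-- The functions `f ∈ Λ(Ω)` with `‖Df‖_∞ ≤ 1`. -/
def lipBall : Set (Linf Ω) :=
  {f ∈ lipSet Ω | eLpNorm (diffQuot f) ∞ ((leb Ω).prod (leb Ω)) ≤ 1}

/-- `L(T) = sup {|[M_f, T]|₂ : f ∈ Λ(Ω), ‖Df‖_∞ ≤ 1}`, with values in `[0, ∞]`. -/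
def lipNorm (T : L2 Ω →L[ℂ] L2 Ω) : ℝ≥0∞ :=
  ⨆ f ∈ lipBall Ω, hsNorm (mulOp f * T - T * mulOp f)

lemma star_mem_lipBall {f : Linf Ω} (hf : f ∈ lipBall Ω) : star f ∈ lipBall Ω := by
  have h := eLpNorm_congr_norm_ae (p := ∞) (norm_diffQuot_star f)
  refine ⟨⟨aestronglyMeasurable_diffQuot _, ?_⟩, ?_⟩
  · rw [h]
    exact hf.1.2
  · rw [h]
    exact hf.2

lemma le_lipNorm {f : Linf Ω} (hf : f ∈ lipBall Ω) (T : L2 Ω →L[ℂ] L2 Ω) :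
    hsNorm (mulOp f * T - T * mulOp f) ≤ lipNorm T :=
  le_iSup₂ (f := fun f (_ : f ∈ lipBall Ω) => hsNorm (mulOp f * T - T * mulOp f)) f hf

lemma lipNorm_star_le (T : L2 Ω →L[ℂ] L2 Ω) : lipNorm (star T) ≤ lipNorm T := by
  refine iSup₂_le fun f hf => ?_
  refine le_trans (le_of_eq ?_) (le_lipNorm (star_mem_lipBall hf) T)
  rw [← hsNorm_star, star_sub, star_mul, star_mul, star_star, star_mulOp, ← hsNorm_neg, neg_sub]

lemma lipNorm_star (T : L2 Ω →L[ℂ] L2 Ω) : lipNorm (star T) = lipNorm T :=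
  le_antisymm (lipNorm_star_le T) (by simpa using lipNorm_star_le (star T))

lemma lipNorm_add_le (S T : L2 Ω →L[ℂ] L2 Ω) : lipNorm (S + T) ≤ lipNorm S + lipNorm T := by
  refine iSup₂_le fun f hf => ?_
  have : mulOp f * (S + T) - (S + T) * mulOp f
      = (mulOp f * S - S * mulOp f) + (mulOp f * T - T * mulOp f) := by noncomm_ring
  rw [this]
  exact (hsNorm_add_le _ _).trans (add_le_add (le_lipNorm hf S) (le_lipNorm hf T))

lemma lipNorm_mul_le (S T : L2 Ω →L[ℂ] L2 Ω) :
    lipNorm (S * T) ≤ lipNorm S * ‖T‖ₑ + ‖S‖ₑ * lipNorm T := by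
  refine iSup₂_le fun f hf => ?_
  have : mulOp f * (S * T) - (S * T) * mulOp f
      = (mulOp f * S - S * mulOp f) * T + S * (mulOp f * T - T * mulOp f) := by noncomm_ring
  rw [this]
  refine (hsNorm_add_le _ _).trans (add_le_add ?_ ?_)
  · exact (hsNorm_mul_le_right _ _).trans (mul_le_mul_left (le_lipNorm hf S) _)
  · exact (hsNorm_mul_le_left _ _).trans (mul_le_mul_right (le_lipNorm hf T) _)

lemma lipNorm_neg (T : L2 Ω →L[ℂ] L2 Ω) : lipNorm (-T) = lipNorm T := by
  unfold lipNorm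
  refine iSup_congr fun f => iSup_congr fun _ => ?_
  rw [← hsNorm_neg]
  congr 1
  noncomm_ring

lemma lipNorm_algebraMap (c : ℂ) : lipNorm (algebraMap ℂ (L2 Ω →L[ℂ] L2 Ω) c) = 0 := by
  refine le_antisymm (iSup₂_le fun f _ => ?_) zero_le
  rw [← Algebra.commutes, sub_self, hsNorm_zero]

lemma lipNorm_smul (c : ℂ) (T : L2 Ω →L[ℂ] L2 Ω) : lipNorm (c • T) = ‖c‖ₑ * lipNorm T := by
  unfold lipNorm
  simp_rw [ENNReal.mul_iSup, ← hsNorm_smul, smul_sub, mul_smul_comm, smul_mul_assoc]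

variable (Ω)

/-- `EΛ(Ω) = {T ∈ ℬ(L²(Ω, λ)) : L(T) < ∞}` as a `*`-subalgebra of `ℬ(L²(Ω, λ))`. -/
def eLambda : StarSubalgebra ℂ (L2 Ω →L[ℂ] L2 Ω) where
  carrier := {T | lipNorm T < ∞}
  mul_mem' := fun {S T} hS hT => (lipNorm_mul_le S T).trans_lt
    (ENNReal.add_lt_top.2 ⟨ENNReal.mul_lt_top hS enorm_lt_top, ENNReal.mul_lt_top enorm_lt_top hT⟩)
  add_mem' := fun {S T} hS hT => (lipNorm_add_le S T).trans_lt (ENNReal.add_lt_top.2 ⟨hS, hT⟩)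
  algebraMap_mem' := fun c => by
    rw [Set.mem_ofPred_eq, lipNorm_algebraMap]
    exact ENNReal.zero_lt_top
  star_mem' := fun {T} hT => by
    rw [Set.mem_ofPred_eq, lipNorm_star]
    exact hT

/-- The algebra `EΛ(Ω)` as a type of its own, since its norm `|||T||| = ‖T‖ + L(T)` is not the
operator norm. -/
def EAlg : Type := eLambda Ω

instance : Ring (EAlg Ω) := inferInstanceAs (Ring (eLambda Ω))

instance : Algebra ℂ (EAlg Ω) := inferInstanceAs (Algebra ℂ (eLambda Ω))

instance : StarRing (EAlg Ω) := inferInstanceAs (StarRing (eLambda Ω))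

instance : StarModule ℂ (EAlg Ω) := inferInstanceAs (StarModule ℂ (eLambda Ω))

/-- The inclusion `EΛ(Ω) → ℬ(L²(Ω, λ))`. -/
def toB : EAlg Ω →⋆ₐ[ℂ] (L2 Ω →L[ℂ] L2 Ω) := (eLambda Ω).subtype

variable {Ω}

lemma toB_injective : Function.Injective (toB Ω) := Subtype.val_injective

lemma lipNorm_toB_lt_top (x : EAlg Ω) : lipNorm (toB Ω x) < ∞ := x.2

variable (Ω)

/-- The norm `|||T||| = ‖T‖ + L(T)` on `EΛ(Ω)`. -/
def eNorm : AddGroupNorm (EAlg Ω) where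
  toFun x := ‖toB Ω x‖ + (lipNorm (toB Ω x)).toReal
  map_zero' := by
    have := lipNorm_algebraMap (Ω := Ω) 0
    rw [map_zero] at this
    simp [this]
  add_le' := fun x y => by
    have h := ENNReal.toReal_mono
      (ENNReal.add_lt_top.2 ⟨lipNorm_toB_lt_top x, lipNorm_toB_lt_top y⟩).ne
      (lipNorm_add_le (toB Ω x) (toB Ω y))
    rw [ENNReal.toReal_add (lipNorm_toB_lt_top x).ne (lipNorm_toB_lt_top y).ne] at h
    have h2 := norm_add_le (toB Ω x) (toB Ω y)
    rw [map_add]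
    linarith
  neg' := fun x => by rw [map_neg, norm_neg, lipNorm_neg]
  eq_zero_of_map_eq_zero' := fun x hx => by
    have h1 := norm_nonneg (toB Ω x)
    have h2 : 0 ≤ (lipNorm (toB Ω x)).toReal := ENNReal.toReal_nonneg
    have h3 : ‖toB Ω x‖ = 0 := by linarith
    exact toB_injective (by rw [norm_eq_zero.1 h3, map_zero])

instance : NormedRing (EAlg Ω) :=
  { (eNorm Ω).toNormedAddCommGroup, (inferInstance : Ring (EAlg Ω)) with
    norm_mul_le := fun x y => by
      change ‖toB Ω (x * y)‖ + (lipNorm (toB Ω (x * y))).toReal ≤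
        (‖toB Ω x‖ + (lipNorm (toB Ω x)).toReal) * (‖toB Ω y‖ + (lipNorm (toB Ω y)).toReal)
      have hx := (lipNorm_toB_lt_top x).ne
      have hy := (lipNorm_toB_lt_top y).ne
      have h1 := ENNReal.mul_lt_top (lipNorm_toB_lt_top x) (enorm_lt_top (x := toB Ω y))
      have h2 := ENNReal.mul_lt_top (enorm_lt_top (x := toB Ω x)) (lipNorm_toB_lt_top y)
      have h := ENNReal.toReal_mono (ENNReal.add_lt_top.2 ⟨h1, h2⟩).ne
        (lipNorm_mul_le (toB Ω x) (toB Ω y))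
      rw [ENNReal.toReal_add h1.ne h2.ne, ENNReal.toReal_mul, ENNReal.toReal_mul,
        toReal_enorm, toReal_enorm] at h
      rw [map_mul]
      have h3 := norm_mul_le (toB Ω x) (toB Ω y)
      have h4 : 0 ≤ (lipNorm (toB Ω x)).toReal * (lipNorm (toB Ω y)).toReal := by positivity
      nlinarith }

variable {Ω}

lemma norm_def (x : EAlg Ω) : ‖x‖ = ‖toB Ω x‖ + (lipNorm (toB Ω x)).toReal := rfl

lemma norm_toB_le (x : EAlg Ω) : ‖toB Ω x‖ ≤ ‖x‖ := by
  rw [norm_def]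
  exact le_add_of_nonneg_right ENNReal.toReal_nonneg

variable (Ω)

instance : NormedAlgebra ℂ (EAlg Ω) where
  norm_smul_le := fun c x => by
    rw [norm_def, norm_def, map_smul, lipNorm_smul, norm_smul, ENNReal.toReal_mul, toReal_enorm,
      mul_add]

instance : NormedStarGroup (EAlg Ω) where
  norm_star_le := fun x => by
    have h : ‖star (toB Ω x)‖ = ‖toB Ω x‖ := norm_star (toB Ω x)
    rw [norm_def, norm_def, map_star, h, lipNorm_star]

/-- The ideal `𝒦Λ(Ω) = {T ∈ EΛ(Ω) : T compact}` of `EΛ(Ω)`. -/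
def kLambda : Ideal (EAlg Ω) where
  carrier := {x | IsCompactOperator (toB Ω x)}
  add_mem' := fun {x y} hx hy => by
    have : IsCompactOperator (toB Ω x + toB Ω y : L2 Ω →L[ℂ] L2 Ω) := hx.add hy
    rwa [← map_add] at this
  zero_mem' := by
    have : IsCompactOperator (0 : L2 Ω →L[ℂ] L2 Ω) := isCompactOperator_zero
    rwa [← map_zero (toB Ω)] at this
  smul_mem' := fun c x hx => by
    have : IsCompactOperator (toB Ω c * toB Ω x : L2 Ω →L[ℂ] L2 Ω) := hx.clm_comp (toB Ω c)
    rwa [← map_mul] at this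

variable {Ω} in
lemma mem_kLambda {x : EAlg Ω} : x ∈ kLambda Ω ↔ toB Ω x ∈ compactIdeal (L2 Ω) := Iff.rfl

instance : (kLambda Ω).IsTwoSided where
  mul_mem_of_left := fun {x} y hx => by
    rw [mem_kLambda, map_mul]
    exact Ideal.mul_mem_right _ _ (mem_kLambda.1 hx)

instance : IsStarIdeal (kLambda Ω) where
  star_mem := fun {x} hx => by
    rw [mem_kLambda, map_star]
    exact IsStarIdeal.star_mem (mem_kLambda.1 hx)

lemma continuous_toB : Continuous (toB Ω) :=
  AddMonoidHomClass.continuous_of_bound (toB Ω) 1 fun x => by simpa using norm_toB_le x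

instance : IsClosed (kLambda Ω : Set (EAlg Ω)) :=
  IsClosed.preimage (continuous_toB Ω)
    (inferInstance : IsClosed (compactIdeal (L2 Ω) : Set (L2 Ω →L[ℂ] L2 Ω)))

/-- The corona `(E/𝒦)Λ(Ω) = EΛ(Ω)/𝒦Λ(Ω)` with its quotient norm and involution. -/
abbrev Corona : Type := EAlg Ω ⧸ kLambda Ω

end ELambda

end ELam

end

/-!
Write `[M_f, T]` for the commutator with a multiplication operator and call `f` admissible if
`f ∈ Λ(Ω)` and `‖Df‖_∞ ≤ 1`. Everything rests on a quasicentral approximate unit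
(`IsQuasicentralUnit`): compact integral operators `A n` with `‖A n‖, ‖1 - A n‖ ≤ 1`, tending
strongly to the identity, with `L(A n) → 0`.

Such a sequence exists because the plane has dimension two
(`isQuasicentralUnit_avgProj`). The projection onto the functions on a box that are constant on
dyadic squares of side `2⁻ᵏ` has `L` bounded independently of `k`, and for different levels
`k ≤ l` the commutators are almost orthogonal, with Hilbert--Schmidt inner product of order
`4 ^ (k - l)`, up to a factor for the area of the box (`lintegral_cellKer_mul_le`). The average
over `N` consecutive levels therefore has `L² = O(1 / N)` on a fixed box.

For an integral operator with kernel `k(s, t)` the Hilbert--Schmidt norm of `[M_f, T]` is the `L²`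
norm of `(f(s) - f(t)) k(s, t)`, so that domination of difference quotients gives domination of
commutators. Replacing `y` by `A n * y` extends this to all bounded `y`
(`IsQuasicentralUnit.hsNorm_comm_le`), even though `y` itself need not have a kernel. In
consequence `L(y)` is computed on the truncations `z_R` of the coordinate function
(`IsQuasicentralUnit.lipNorm_le`), and if `L(x) < ∞` then `[z_R, x]` is Cauchy in the
Hilbert--Schmidt norm as `R → ∞`. This makes the convergence of `(1 - A n) * [M_f, x]` to `0`
uniform in admissible `f`, and yields `L((1 - A n) * x) → 0`
(`IsQuasicentralUnit.tendsto_lipNorm_one_sub_mul`).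

Since `x` and `(1 - A n) * x` differ by an element of `𝒦Λ(Ω)`, and `‖(1 - A n) * x‖` tends to the
norm of `x + 𝒦`, the quotient norms on `(E/𝒦)Λ(Ω)` and on the Calkin algebra agree. The
`C*`-identity is inherited from the Calkin algebra, where it follows from
`‖x (1 - A n)*‖² = ‖(1 - A n) x* x (1 - A n)*‖`. Completeness of `EΛ(Ω)` is the lower
semicontinuity of `L`, and it makes the image of `(E/𝒦)Λ(Ω)` in `ℬ/𝒦` closed.
-/

noncomputable section

namespace ELam

open Filter Topology

/-! ### Limits of operators in the Hilbert--Schmidt and operator norms -/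

section HilbertSchmidtLimits

variable {H : Type*} [NormedAddCommGroup H] [InnerProductSpace ℂ H]

/-- Left multiplication by a bounded sequence tending strongly to `0` sends a compact operator to
a null sequence in the operator norm. -/
lemma tendsto_norm_mul_of_isCompactOperator {B : ℕ → H →L[ℂ] H} (hB : ∀ n, ‖B n‖ ≤ 1)
    (hB0 : ∀ x, Tendsto (fun n => B n x) atTop (𝓝 0)) {K : H →L[ℂ] H} (hK : IsCompactOperator K) :
    Tendsto (fun n => ‖B n * K‖) atTop (𝓝 0) := by
  rw [Metric.tendsto_nhds]
  intro ε hε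
  have htb := (hK.isCompact_closure_image_ball (f := (K : H →ₗ[ℂ] H)) 2).totallyBounded.subset
    subset_closure
  obtain ⟨t, ht, hcov⟩ := Metric.totallyBounded_iff.1 htb (ε / 3) (by positivity)
  have hev : ∀ᶠ n in atTop, ∀ c ∈ t, ‖B n c‖ < ε / 3 := by
    rw [Filter.eventually_all_finite ht]
    intro c _
    have := (hB0 c).norm
    rw [norm_zero] at this
    exact this.eventually_lt_const (by positivity)
  filter_upwards [hev] with n hn
  rw [dist_zero_right, norm_norm]
  refine lt_of_le_of_lt (b := 2 * ε / 3) ?_ (by linarith)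
  refine ContinuousLinearMap.opNorm_le_of_unit_norm (by positivity) fun x hx => ?_
  have hx2 : K x ∈ (K : H →ₗ[ℂ] H) '' Metric.ball 0 2 :=
    Set.mem_image_of_mem _ (by rw [mem_ball_zero_iff, hx]; norm_num)
  obtain ⟨c, hct, hc⟩ := Set.mem_iUnion₂.1 (hcov hx2)
  rw [mem_ball_iff_norm] at hc
  calc ‖(B n * K) x‖ = ‖B n (K x - c) + B n c‖ := by
        rw [← map_add, sub_add_cancel]; rfl
    _ ≤ ‖B n (K x - c)‖ + ‖B n c‖ := norm_add_le _ _
    _ ≤ 1 * ‖K x - c‖ + ‖B n c‖ := by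
        gcongr
        exact (B n).le_of_opNorm_le (hB n) _
    _ ≤ 2 * ε / 3 := by linarith [hn c hct]

variable [CompleteSpace H]

lemma hsNorm_sq (T : H →L[ℂ] H) : hsNorm T ^ 2 = ∑' i, ‖T (stdBasis H i)‖ₑ ^ 2 := by
  rw [hsNorm, ← ENNReal.rpow_natCast, ← ENNReal.rpow_mul]
  norm_num

lemma hsNorm_sub_le (S T : H →L[ℂ] H) : hsNorm (S - T) ≤ hsNorm S + hsNorm T := by
  rw [sub_eq_add_neg, ← hsNorm_neg T]
  exact hsNorm_add_le _ _

/-- Joint lower semicontinuity of the sum of the squared Hilbert--Schmidt norms of two operators,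
for the strong operator topology. -/
lemma hsNorm_sq_add_sq_le_of_tendsto {S T : H →L[ℂ] H} {Sn Tn : ℕ → H →L[ℂ] H} {c : ℕ → ℝ≥0∞}
    {d : ℝ≥0∞} (hS : ∀ x, Tendsto (fun n => Sn n x) atTop (𝓝 (S x)))
    (hT : ∀ x, Tendsto (fun n => Tn n x) atTop (𝓝 (T x)))
    (hc : ∀ n, hsNorm (Sn n) ^ 2 + hsNorm (Tn n) ^ 2 ≤ c n) (hd : Tendsto c atTop (𝓝 d)) :
    hsNorm S ^ 2 + hsNorm T ^ 2 ≤ d := by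
  rw [hsNorm_sq, hsNorm_sq, ← ENNReal.tsum_add, ENNReal.tsum_eq_iSup_sum]
  refine iSup_le fun s => ?_
  have hlim : Tendsto (fun n => ∑ i ∈ s, (‖Sn n (stdBasis H i)‖ₑ ^ 2 + ‖Tn n (stdBasis H i)‖ₑ ^ 2))
      atTop (𝓝 (∑ i ∈ s, (‖S (stdBasis H i)‖ₑ ^ 2 + ‖T (stdBasis H i)‖ₑ ^ 2))) :=
    tendsto_finsetSum s fun i _ =>
      (ENNReal.Tendsto.pow ((hS _).enorm)).add (ENNReal.Tendsto.pow ((hT _).enorm))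
  refine le_of_tendsto_of_tendsto' hlim hd fun n => ?_
  refine le_trans ?_ (hc n)
  rw [hsNorm_sq, hsNorm_sq, ← ENNReal.tsum_add]
  exact ENNReal.sum_le_tsum s

lemma hsNorm_le_of_tendsto {S : H →L[ℂ] H} {Sn : ℕ → H →L[ℂ] H} {c : ℝ≥0∞}
    (hS : ∀ x, Tendsto (fun n => Sn n x) atTop (𝓝 (S x)))
    (hc : ∀ᶠ n in atTop, hsNorm (Sn n) ≤ c) : hsNorm S ≤ c := by
  obtain ⟨N, hN⟩ := eventually_atTop.1 hc
  have h := hsNorm_sq_add_sq_le_of_tendsto (S := S) (T := 0) (Sn := fun n => Sn (n + N))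
    (Tn := fun _ => 0) (c := fun _ => c ^ 2) (d := c ^ 2)
    (fun x => (tendsto_add_atTop_iff_nat N).2 (hS x)) (fun x => tendsto_const_nhds)
    (fun n => by
      simp only [hsNorm_zero]
      simpa using pow_le_pow_left' (hN (n + N) (by omega)) 2) tendsto_const_nhds
  simp only [hsNorm_zero] at h
  exact (ENNReal.pow_le_pow_left_iff two_ne_zero).1 (by simpa using h)

/-- Left multiplication by a bounded sequence tending strongly to `0` sends a Hilbert--Schmidt
operator to a null sequence in the Hilbert--Schmidt norm. -/
lemma tendsto_hsNorm_mul {B : ℕ → H →L[ℂ] H} (hB : ∀ n, ‖B n‖ ≤ 1)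
    (hB0 : ∀ x, Tendsto (fun n => B n x) atTop (𝓝 0)) {C : H →L[ℂ] H} (hC : hsNorm C ≠ ∞) :
    Tendsto (fun n => hsNorm (B n * C)) atTop (𝓝 0) := by
  let : MeasurableSpace (basisIndex H) := ⊤
  have key : Tendsto (fun n => hsNorm (B n * C) ^ 2) atTop (𝓝 0) := by
    simp_rw [hsNorm_sq, ← lintegral_count]
    have := tendsto_lintegral_of_dominated_convergence (μ := Measure.count)
      (F := fun n i => ‖(B n * C) (stdBasis H i)‖ₑ ^ 2) (f := fun _ => 0)
      (fun i => ‖C (stdBasis H i)‖ₑ ^ 2) (fun n => measurable_from_top) ?_ ?_ ?_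
    · simpa using this
    · intro n
      refine Eventually.of_forall fun i => ?_
      refine pow_le_pow_left' (((B n).le_opENorm _).trans ?_) 2
      calc _ ≤ 1 * ‖C (stdBasis H i)‖ₑ := by
            refine mul_le_mul' ?_ le_rfl
            rw [← ofReal_norm]
            exact ENNReal.ofReal_le_one.2 (hB n)
        _ = _ := one_mul _
    · rw [lintegral_count, ← hsNorm_sq]
      exact ENNReal.pow_ne_top hC
    · refine Eventually.of_forall fun i => ?_
      have := ENNReal.Tendsto.pow (n := 2) ((hB0 (C (stdBasis H i))).enorm)
      simpa using this
  have h2 := (ENNReal.continuous_rpow_const (y := 1 / 2)).tendsto 0 |>.comp key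
  rw [ENNReal.zero_rpow_of_pos (by norm_num)] at h2
  refine h2.congr fun n => ?_
  simp only [Function.comp]
  rw [← ENNReal.rpow_natCast, ← ENNReal.rpow_mul]
  norm_num

end HilbertSchmidtLimits

/-! ### Integral operators and their commutators with multiplication operators -/

section Kernels

variable {Ω : Set ℂ}

/-- The commutator `[M_f, T]`. -/
abbrev comm (f : Linf Ω) (T : L2 Ω →L[ℂ] L2 Ω) : L2 Ω →L[ℂ] L2 Ω :=
  mulOp f * T - T * mulOp f

/-- `T` is the integral operator whose kernel at `(s, t)` is the complex conjugate of `w s t`. -/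
def HasKernel (T : L2 Ω →L[ℂ] L2 Ω) (w : ℂ → L2 Ω) : Prop :=
  ∀ b, T b =ᵐ[leb Ω] fun s => inner ℂ (w s) b

lemma enorm_sq_eq_lintegral (g : L2 Ω) : ‖g‖ₑ ^ 2 = ∫⁻ t, ‖g t‖ₑ ^ 2 ∂leb Ω := by
  have h := eLpNorm_nnreal_pow_eq_lintegral (f := g) (μ := leb Ω) (p := 2) two_ne_zero
  rw [Lp.enorm_def]
  simpa using h

instance : Countable (basisIndex (L2 Ω)) := by
  have hd : (Set.univ : Set (basisIndex (L2 Ω))).PairwiseDisjoint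
      fun i => Metric.ball (stdBasis (L2 Ω) i) (1 / 2) := by
    intro i _ j _ hij
    refine Metric.ball_disjoint_ball ?_
    have h := (stdBasis (L2 Ω)).orthonormal
    have h1 : ‖stdBasis (L2 Ω) i - stdBasis (L2 Ω) j‖ ^ 2 = 2 := by
      rw [@norm_sub_sq ℂ, h.1, h.1, h.2 hij]
      norm_num
    rw [dist_eq_norm]
    nlinarith [norm_nonneg (stdBasis (L2 Ω) i - stdBasis (L2 Ω) j)]
  have : Fact ((2 : ℝ≥0∞) ≠ ∞) := ⟨by norm_num⟩
  have := hd.countable_of_isOpen (fun _ _ => Metric.isOpen_ball)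
    (fun i _ => Metric.nonempty_ball.2 (by norm_num))
  exact Set.countable_univ_iff.1 this

/-- Parseval's identity for almost every slice of the kernel. -/
lemma HasKernel.sum_enorm_sq {T : L2 Ω →L[ℂ] L2 Ω} {w : ℂ → L2 Ω} (h : HasKernel T w) :
    (fun s => ‖w s‖ₑ ^ 2) =ᵐ[leb Ω] fun s => ∑' i, ‖T (stdBasis (L2 Ω) i) s‖ₑ ^ 2 := by
  filter_upwards [ae_all_iff.2 fun i => h (stdBasis (L2 Ω) i)] with s hs
  have h1 := enorm_sq_eq_tsum (stdBasis (L2 Ω)) (w s)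
  norm_cast at h1
  rw [h1]
  refine tsum_congr fun i => ?_
  rw [hs i, ← inner_conj_symm, RCLike.enorm_conj]

lemma HasKernel.aemeasurable {T : L2 Ω →L[ℂ] L2 Ω} {w : ℂ → L2 Ω} (h : HasKernel T w) :
    AEMeasurable (fun s => ‖w s‖ₑ ^ 2) (leb Ω) := by
  refine AEMeasurable.congr ?_ h.sum_enorm_sq.symm
  refine (Measurable.tsum fun i => ?_).aemeasurable
  have := (Lp.stronglyMeasurable (T (stdBasis (L2 Ω) i))).measurable
  fun_prop

lemma HasKernel.hsNorm_sq {T : L2 Ω →L[ℂ] L2 Ω} {w : ℂ → L2 Ω} (h : HasKernel T w) :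
    hsNorm T ^ 2 = ∫⁻ s, ‖w s‖ₑ ^ 2 ∂leb Ω := by
  rw [ELam.hsNorm_sq, lintegral_congr_ae h.sum_enorm_sq, lintegral_tsum]
  · exact tsum_congr fun i => enorm_sq_eq_lintegral _
  · intro i
    have := (Lp.stronglyMeasurable (T (stdBasis (L2 Ω) i))).measurable
    fun_prop

lemma HasKernel.mul_right {T : L2 Ω →L[ℂ] L2 Ω} {w : ℂ → L2 Ω} (h : HasKernel T w)
    (S : L2 Ω →L[ℂ] L2 Ω) : HasKernel (T * S) fun s => star S (w s) := by
  intro b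
  filter_upwards [h (S b)] with s hs
  rw [ContinuousLinearMap.star_eq_adjoint, ContinuousLinearMap.adjoint_inner_left]
  exact hs

/-- The conjugate kernel of `[M_f, T]`, in terms of that of `T`. -/
def commKernel (f : Linf Ω) (w : ℂ → L2 Ω) (s : ℂ) : L2 Ω :=
  star (f s) • w s - mulOp (star f) (w s)

lemma HasKernel.comm {T : L2 Ω →L[ℂ] L2 Ω} {w : ℂ → L2 Ω} (h : HasKernel T w) (f : Linf Ω) :
    HasKernel (comm f T) (commKernel f w) := by
  intro b
  have h0 : ELam.comm f T b = mulOp f (T b) - T (mulOp f b) := rfl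
  rw [h0]
  filter_upwards [h b, h (mulOp f b), mulOp_coeFn f (T b),
    Lp.coeFn_sub (mulOp f (T b)) (T (mulOp f b))] with s h1 h2 h3 h4
  rw [h4, Pi.sub_apply, h3, h1, h2, commKernel, inner_sub_left, inner_smul_left, ← star_mulOp,
    ContinuousLinearMap.star_eq_adjoint, ContinuousLinearMap.adjoint_inner_left]
  simp

lemma enorm_sq_commKernel (f : Linf Ω) (w : ℂ → L2 Ω) (s : ℂ) :
    ‖commKernel f w s‖ₑ ^ 2 = ∫⁻ t, ‖f s - f t‖ₑ ^ 2 * ‖w s t‖ₑ ^ 2 ∂leb Ω := by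
  rw [enorm_sq_eq_lintegral]
  refine lintegral_congr_ae ?_
  filter_upwards [Lp.coeFn_sub (star (f s) • w s) (mulOp (star f) (w s)),
    Lp.coeFn_smul (star (f s)) (w s), mulOp_coeFn (star f) (w s), Lp.coeFn_star f] with t h1 h2 h3 h4
  rw [commKernel, h1, Pi.sub_apply, h2, h3, h4, Pi.smul_apply, Pi.star_apply, smul_eq_mul,
    ← sub_mul, enorm_mul, mul_pow, ← star_sub]
  exact congrArg (· ^ 2 * _) (RCLike.enorm_conj _)

/-- The Hilbert--Schmidt norm of `[M_f, T]` is the `L²` norm of the kernel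
`(f(s) - f(t)) k(s, t)`. -/
lemma HasKernel.hsNorm_comm_sq {T : L2 Ω →L[ℂ] L2 Ω} {w : ℂ → L2 Ω} (h : HasKernel T w)
    (f : Linf Ω) :
    hsNorm (ELam.comm f T) ^ 2 =
      ∫⁻ s, ∫⁻ t, ‖f s - f t‖ₑ ^ 2 * ‖w s t‖ₑ ^ 2 ∂leb Ω ∂leb Ω := by
  rw [(h.comm f).hsNorm_sq]
  simp_rw [enorm_sq_commKernel]

/-- Domination of commutators by domination of difference quotients, for integral operators. -/
lemma HasKernel.hsNorm_comm_le {T : L2 Ω →L[ℂ] L2 Ω} {w : ℂ → L2 Ω} (h : HasKernel T w)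
    {f g : Linf Ω} {u : ℕ → Linf Ω}
    (hu : ∀ᵐ s ∂leb Ω, ∀ᵐ t ∂leb Ω, ‖f s - f t‖ₑ ^ 2 + ‖g s - g t‖ₑ ^ 2 ≤
      liminf (fun n => ‖u n s - u n t‖ₑ ^ 2) atTop) :
    hsNorm (ELam.comm f T) ^ 2 + hsNorm (ELam.comm g T) ^ 2 ≤
      liminf (fun n => hsNorm (ELam.comm (u n) T) ^ 2) atTop := by
  have hm : ∀ (f : Linf Ω) (s : ℂ), Measurable fun t => ‖f s - f t‖ₑ ^ 2 * ‖w s t‖ₑ ^ 2 := by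
    intro f s
    have h1 := (Lp.stronglyMeasurable f).measurable
    have h2 := (Lp.stronglyMeasurable (w s)).measurable
    fun_prop
  have hM : ∀ f : Linf Ω,
      AEMeasurable (fun s => ∫⁻ t, ‖f s - f t‖ₑ ^ 2 * ‖w s t‖ₑ ^ 2 ∂leb Ω) (leb Ω) := by
    intro f
    simp_rw [← enorm_sq_commKernel]
    exact (h.comm f).aemeasurable
  simp_rw [h.hsNorm_comm_sq]
  rw [← lintegral_add_left' (hM f)]
  refine le_trans (lintegral_mono_ae ?_) (lintegral_liminf_le' fun n => hM (u n))
  filter_upwards [hu] with s hs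
  rw [← lintegral_add_left (hm f s)]
  refine le_trans (lintegral_mono_ae ?_) (lintegral_liminf_le fun n => hm (u n) s)
  filter_upwards [hs] with t ht
  rw [← add_mul]
  refine (mul_le_mul' ht le_rfl).trans ?_
  have := ENNReal.le_liminf_mul (f := atTop) (u := fun n => ‖u n s - u n t‖ₑ ^ 2)
    (v := fun _ => ‖w s t‖ₑ ^ 2)
  rw [liminf_const] at this
  exact this

end Kernels

/-! ### Essentially Lipschitz functions -/

section Lipschitz

variable {Ω : Set ℂ}

lemma mem_lipBall_of_ae_eq {f : Linf Ω} {F : ℂ → ℂ} (hF : f =ᵐ[leb Ω] F)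
    (hl : ∀ s t, ‖F s - F t‖ ≤ ‖s - t‖) : f ∈ lipBall Ω := by
  have hb : ∀ᵐ p ∂((leb Ω).prod (leb Ω)), ‖diffQuot f p‖ ≤ 1 := by
    filter_upwards [Measure.quasiMeasurePreserving_fst.ae hF,
      Measure.quasiMeasurePreserving_snd.ae hF] with p h1 h2
    rw [diffQuot, h1, h2, norm_div]
    exact div_le_one_of_le₀ (hl _ _) (norm_nonneg _)
  refine ⟨memLp_top_of_bound (aestronglyMeasurable_diffQuot f) 1 hb, ?_⟩
  rw [eLpNorm_exponent_top]
  refine (eLpNormEssSup_le_of_ae_bound hb).trans ?_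
  simp

lemma enorm_sub_le_of_mem_lipBall {f : Linf Ω} (hf : f ∈ lipBall Ω) :
    ∀ᵐ s ∂leb Ω, ∀ᵐ t ∂leb Ω, ‖f s - f t‖ₑ ≤ ‖s - t‖ₑ := by
  refine Measure.ae_ae_of_ae_prod (p := fun p : ℂ × ℂ => ‖f p.1 - f p.2‖ₑ ≤ ‖p.1 - p.2‖ₑ) ?_
  have h := hf.2
  rw [eLpNorm_exponent_top] at h
  filter_upwards [enorm_ae_le_eLpNormEssSup (diffQuot f) ((leb Ω).prod (leb Ω))] with p hp
  have h2 := hp.trans h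
  rcases eq_or_ne p.1 p.2 with h3 | h3
  · simp [h3]
  · have h4 : f p.1 - f p.2 = diffQuot f p * (p.1 - p.2) := by
      rw [diffQuot, div_mul_cancel₀ _ (sub_ne_zero.2 h3)]
    rw [h4, enorm_mul]
    exact mul_le_of_le_one_left' h2

lemma zero_mem_lipBall : (0 : Linf Ω) ∈ lipBall Ω :=
  mem_lipBall_of_ae_eq (F := fun _ => 0) (Lp.coeFn_zero _ _ _) (by simp)

lemma mulOp_sub (f g : Linf Ω) : mulOp (f - g) = mulOp f - mulOp g :=
  map_sub ((ContinuousLinearMap.mul ℂ ℂ).holderL (leb Ω) ∞ 2 2) f g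

lemma comm_sub_left (f g : Linf Ω) (T : L2 Ω →L[ℂ] L2 Ω) :
    comm (f - g) T = comm f T - comm g T := by
  rw [comm, mulOp_sub, comm, comm]
  noncomm_ring

lemma comm_mul (f : Linf Ω) (S T : L2 Ω →L[ℂ] L2 Ω) :
    comm f (S * T) = comm f S * T + S * comm f T := by
  simp only [comm]
  noncomm_ring

lemma comm_one_sub (f : Linf Ω) (T : L2 Ω →L[ℂ] L2 Ω) : comm f (1 - T) = -comm f T := by
  simp only [comm]
  noncomm_ring

end Lipschitz

/-! ### Truncations of the coordinate function -/

section Truncation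

/-- The nearest point to `x` in `[-R, R]`. -/
def clamp (R x : ℝ) : ℝ := max (-R) (min R x)

lemma measurable_clamp (R : ℝ) : Measurable (clamp R) := by
  unfold clamp
  fun_prop

lemma abs_clamp_le {R : ℝ} (hR : 0 ≤ R) (x : ℝ) : |clamp R x| ≤ R := by
  rw [abs_le, clamp]
  exact ⟨le_max_left _ _, max_le (by linarith) (min_le_left _ _)⟩

lemma clamp_eq_self {R x : ℝ} (h : |x| ≤ R) : clamp R x = x := by
  rw [abs_le] at h
  rw [clamp, min_eq_right h.2, max_eq_right h.1]

lemma clamp_sub_clamp_sq_le (R a b : ℝ) : (clamp R a - clamp R b) ^ 2 ≤ (a - b) ^ 2 := by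
  rw [sq_le_sq]
  unfold clamp
  calc _ ≤ |min R a - min R b| := by
        simpa using abs_max_sub_max_le_max (-R) (min R a) (-R) (min R b)
    _ ≤ _ := by simpa using abs_min_sub_min_le_max R a R b

/-- Truncation at a higher level increases differences, and the increment has the same sign. -/
lemma clamp_increment {R R' : ℝ} (hR : 0 ≤ R) (h : R ≤ R') (a b : ℝ) :
    ((clamp R' a - clamp R a) - (clamp R' b - clamp R b)) ^ 2 + (clamp R a - clamp R b) ^ 2 ≤
      (clamp R' a - clamp R' b) ^ 2 := by
  have mono : Monotone (clamp R) := fun x y hxy =>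
    max_le_max le_rfl (min_le_min le_rfl hxy)
  have mono' : Monotone fun x => clamp R' x - clamp R x := by
    intro x y hxy
    simp only [clamp, max_def, min_def]
    split_ifs <;> linarith
  have : 0 ≤ (clamp R a - clamp R b) *
      ((clamp R' a - clamp R a) - (clamp R' b - clamp R b)) := by
    rcases le_total a b with hab | hab
    · exact mul_nonneg_of_nonpos_of_nonpos (sub_nonpos.2 (mono hab)) (sub_nonpos.2 (mono' hab))
    · exact mul_nonneg (sub_nonneg.2 (mono hab)) (sub_nonneg.2 (mono' hab))
  nlinarith

/-- The nearest point to `z` in the square `[-R, R]²`. -/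
def clampC (R : ℝ) (z : ℂ) : ℂ := ⟨clamp R z.re, clamp R z.im⟩

lemma measurable_clampC (R : ℝ) : Measurable (clampC R) := by
  have h : clampC R = fun z => (clamp R z.re : ℂ) + (clamp R z.im : ℂ) * Complex.I := by
    funext z
    exact (Complex.re_add_im (clampC R z)).symm
  rw [h]
  have := measurable_clamp R
  fun_prop

lemma norm_clampC_sub_sq (R : ℝ) (s t : ℂ) : ‖clampC R s - clampC R t‖ ^ 2 =
    (clamp R s.re - clamp R t.re) ^ 2 + (clamp R s.im - clamp R t.im) ^ 2 := by
  rw [Complex.sq_norm, Complex.normSq_apply]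
  simp only [clampC, Complex.sub_re, Complex.sub_im]
  ring

lemma norm_sq_eq (z : ℂ) : ‖z‖ ^ 2 = z.re ^ 2 + z.im ^ 2 := by
  rw [Complex.sq_norm, Complex.normSq_apply]
  ring

lemma norm_clampC_sub_le (R : ℝ) (s t : ℂ) : ‖clampC R s - clampC R t‖ ≤ ‖s - t‖ := by
  refine (pow_le_pow_iff_left₀ (norm_nonneg _) (norm_nonneg _) two_ne_zero).1 ?_
  rw [norm_clampC_sub_sq, norm_sq_eq, Complex.sub_re, Complex.sub_im]
  exact add_le_add (clamp_sub_clamp_sq_le _ _ _) (clamp_sub_clamp_sq_le _ _ _)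

lemma norm_clampC_increment {R R' : ℝ} (hR : 0 ≤ R) (h : R ≤ R') (s t : ℂ) :
    ‖(clampC R' s - clampC R s) - (clampC R' t - clampC R t)‖ ^ 2 + ‖clampC R s - clampC R t‖ ^ 2 ≤
      ‖clampC R' s - clampC R' t‖ ^ 2 := by
  rw [norm_clampC_sub_sq, norm_clampC_sub_sq, norm_sq_eq]
  simp only [clampC, Complex.sub_re, Complex.sub_im]
  have h1 := clamp_increment hR h s.re t.re
  have h2 := clamp_increment hR h s.im t.im
  linarith

variable (Ω : Set ℂ)

lemma memLp_clampC (R : ℕ) : MemLp (clampC R) ∞ (leb Ω) := by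
  refine memLp_top_of_bound (measurable_clampC R).aestronglyMeasurable (R + R) ?_
  refine Eventually.of_forall fun z => ?_
  refine (Complex.norm_le_abs_re_add_abs_im _).trans ?_
  exact add_le_add (abs_clamp_le R.cast_nonneg _) (abs_clamp_le R.cast_nonneg _)

/-- The coordinate function, truncated to the square `[-R, R]²`. -/
def trunc (R : ℕ) : Linf Ω := (memLp_clampC Ω R).toLp

lemma trunc_coeFn (R : ℕ) : trunc Ω R =ᵐ[leb Ω] clampC R := MemLp.coeFn_toLp _

lemma trunc_mem_lipBall (R : ℕ) : trunc Ω R ∈ lipBall Ω :=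
  mem_lipBall_of_ae_eq (trunc_coeFn Ω R) (norm_clampC_sub_le R)

lemma trunc_sub_coeFn (R R' : ℕ) :
    (trunc Ω R' - trunc Ω R : Linf Ω) =ᵐ[leb Ω] fun z => clampC R' z - clampC R z := by
  filter_upwards [Lp.coeFn_sub (trunc Ω R') (trunc Ω R), trunc_coeFn Ω R, trunc_coeFn Ω R']
    with z h1 h2 h3
  rw [h1, Pi.sub_apply, h2, h3]

lemma trunc_sub_mem_lipBall {R R' : ℕ} (h : R ≤ R') : trunc Ω R' - trunc Ω R ∈ lipBall Ω := by
  refine mem_lipBall_of_ae_eq (trunc_sub_coeFn Ω R R') fun s t => ?_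
  refine le_trans ?_ (norm_clampC_sub_le R' s t)
  refine (pow_le_pow_iff_left₀ (norm_nonneg _) (norm_nonneg _) two_ne_zero).1 ?_
  have := norm_clampC_increment R.cast_nonneg (Nat.cast_le.2 h) s t
  nlinarith [sq_nonneg ‖clampC R s - clampC R t‖]

lemma trunc_increment {R R' : ℕ} (h : R ≤ R') : ∀ᵐ s ∂leb Ω, ∀ᵐ t ∂leb Ω,
    ‖(trunc Ω R' - trunc Ω R : Linf Ω) s - (trunc Ω R' - trunc Ω R : Linf Ω) t‖ₑ ^ 2
      + ‖trunc Ω R s - trunc Ω R t‖ₑ ^ 2 ≤ ‖trunc Ω R' s - trunc Ω R' t‖ₑ ^ 2 := by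
  have h0 : ∀ z : ℂ, ‖z‖ₑ ^ 2 = ENNReal.ofReal (‖z‖ ^ 2) := fun z => by
    rw [ENNReal.ofReal_pow (norm_nonneg _), ofReal_norm]
  filter_upwards [trunc_sub_coeFn Ω R R', trunc_coeFn Ω R, trunc_coeFn Ω R'] with s h1 h2 h3
  filter_upwards [trunc_sub_coeFn Ω R R', trunc_coeFn Ω R, trunc_coeFn Ω R'] with t h4 h5 h6
  rw [h1, h2, h3, h4, h5, h6, h0, h0, h0, ← ENNReal.ofReal_add (sq_nonneg _) (sq_nonneg _)]
  exact ENNReal.ofReal_le_ofReal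
    (norm_clampC_increment R.cast_nonneg (Nat.cast_le.2 h) s t)

/-- Almost every difference of `z` is eventually a difference of truncations of `z`. -/
lemma trunc_eventually_eq (m : ℕ) : ∀ᵐ s ∂leb Ω, ∀ᵐ t ∂leb Ω,
    ∀ᶠ n in atTop, trunc Ω (m + n) s - trunc Ω (m + n) t = s - t := by
  have key : ∀ᵐ s ∂leb Ω, ∀ᶠ n in atTop, trunc Ω (m + n) s = s := by
    filter_upwards [ae_all_iff.2 (trunc_coeFn Ω)] with s hs
    filter_upwards [eventually_ge_atTop ⌈‖s‖⌉₊] with n hn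
    have h1 : ‖s‖ ≤ (m + n : ℕ) := (Nat.le_ceil _).trans (by exact_mod_cast hn.trans (by omega))
    rw [hs, clampC, clamp_eq_self ((Complex.abs_re_le_norm s).trans h1),
      clamp_eq_self ((Complex.abs_im_le_norm s).trans h1)]
  filter_upwards [key] with s hs
  filter_upwards [key] with t ht
  filter_upwards [hs, ht] with n h1 h2
  rw [h1, h2]

end Truncation

/-! ### Quasicentral approximate units -/

section Quasicentral

variable {Ω : Set ℂ}

/-- A sequence of compact integral operators tending strongly to the identity and asymptotically
commuting, in the Hilbert--Schmidt norm and uniformly in `f ∈ Λ(Ω)` with `‖Df‖_∞ ≤ 1`, with the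
operators `M_f`. -/
structure IsQuasicentralUnit (A : ℕ → L2 Ω →L[ℂ] L2 Ω) : Prop where
  compact : ∀ n, IsCompactOperator (A n)
  norm_le : ∀ n, ‖A n‖ ≤ 1
  norm_one_sub_le : ∀ n, ‖1 - A n‖ ≤ 1
  tendsto : ∀ x, Tendsto (fun n => A n x) atTop (𝓝 x)
  tendsto_lipNorm : Tendsto (fun n => lipNorm (A n)) atTop (𝓝 0)
  hasKernel : ∀ n, ∃ w, HasKernel (A n) w

variable {A : ℕ → L2 Ω →L[ℂ] L2 Ω} (hA : IsQuasicentralUnit A)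
include hA

lemma IsQuasicentralUnit.one_sub_tendsto (x : L2 Ω) :
    Tendsto (fun n => (1 - A n) x) atTop (𝓝 0) := by
  have := (tendsto_const_nhds (x := x)).sub (hA.tendsto x)
  rwa [sub_self] at this

lemma IsQuasicentralUnit.tendsto_lipNorm_mul (y : L2 Ω →L[ℂ] L2 Ω) :
    Tendsto (fun n => lipNorm (A n) * ‖y‖ₑ) atTop (𝓝 0) := by
  have := ENNReal.Tendsto.mul_const (b := ‖y‖ₑ) hA.tendsto_lipNorm (Or.inr enorm_ne_top)
  rwa [zero_mul] at this

/-- Domination of commutators by domination of difference quotients. The operator `y` is replaced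
by the integral operators `A n * y`, whose commutators with `M_f` are close to `A n * [M_f, y]`. -/
lemma IsQuasicentralUnit.hsNorm_comm_le {f g : Linf Ω} {u : ℕ → Linf Ω} (hf : f ∈ lipBall Ω)
    (hg : g ∈ lipBall Ω) (hu : ∀ n, u n ∈ lipBall Ω)
    (hd : ∀ᵐ s ∂leb Ω, ∀ᵐ t ∂leb Ω, ‖f s - f t‖ₑ ^ 2 + ‖g s - g t‖ₑ ^ 2 ≤
      liminf (fun n => ‖u n s - u n t‖ₑ ^ 2) atTop)
    (y : L2 Ω →L[ℂ] L2 Ω) {σ : ℝ≥0∞} (hσ : ∀ n, hsNorm (comm (u n) y) ≤ σ) :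
    hsNorm (comm f y) ^ 2 + hsNorm (comm g y) ^ 2 ≤ σ ^ 2 := by
  rcases eq_or_ne σ ∞ with rfl | hσt
  · simp
  have hε := hA.tendsto_lipNorm_mul y
  set ε : ℕ → ℝ≥0∞ := fun n => lipNorm (A n) * ‖y‖ₑ
  have hcomm : ∀ f ∈ lipBall Ω, ∀ n, hsNorm (comm f (A n) * y) ≤ ε n := fun f hf n =>
    (hsNorm_mul_le_right _ _).trans (mul_le_mul' (le_lipNorm hf (A n)) le_rfl)
  have hlow : ∀ f ∈ lipBall Ω, ∀ n,
      hsNorm (A n * comm f y) ≤ hsNorm (comm f (A n * y)) + ε n := by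
    intro f hf n
    have : A n * comm f y = comm f (A n * y) - comm f (A n) * y := by
      rw [comm_mul]
      abel
    rw [this]
    exact (hsNorm_sub_le _ _).trans (add_le_add le_rfl (hcomm f hf n))
  have hup : ∀ n, hsNorm (comm f (A n * y)) ^ 2 + hsNorm (comm g (A n * y)) ^ 2 ≤
      (σ + ε n) ^ 2 := by
    intro n
    obtain ⟨w, hw⟩ := hA.hasKernel n
    refine ((hw.mul_right y).hsNorm_comm_le hd).trans ?_
    refine (liminf_le_liminf (v := fun _ => (σ + ε n) ^ 2)
      (Eventually.of_forall fun k => ?_)).trans_eq (liminf_const _)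
    refine pow_le_pow_left' ?_ 2
    rw [comm_mul, add_comm]
    refine (hsNorm_add_le _ _).trans (add_le_add ?_ (hcomm _ (hu k) n))
    refine (hsNorm_mul_le_left _ _).trans ?_
    refine (mul_le_mul' ?_ (hσ k)).trans_eq (one_mul _)
    rw [← ofReal_norm]
    exact ENNReal.ofReal_le_one.2 (hA.norm_le n)
  refine hsNorm_sq_add_sq_le_of_tendsto (Sn := fun n => A n * comm f y)
    (Tn := fun n => A n * comm g y)
    (c := fun n => (σ + ε n) ^ 2 + 4 * (ε n * (σ + ε n)) + 2 * ε n ^ 2)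
    (fun x => hA.tendsto _) (fun x => hA.tendsto _) (fun n => ?_) ?_
  · have ha := hlow f hf n
    have hb := hlow g hg n
    have hab := hup n
    set a := hsNorm (comm f (A n * y))
    set b := hsNorm (comm g (A n * y))
    have ha' : a ≤ σ + ε n :=
      (ENNReal.pow_le_pow_left_iff two_ne_zero).1 (le_self_add.trans hab)
    have hb' : b ≤ σ + ε n :=
      (ENNReal.pow_le_pow_left_iff two_ne_zero).1 (le_add_self.trans hab)
    calc _ ≤ (a + ε n) ^ 2 + (b + ε n) ^ 2 := by gcongr
      _ = (a ^ 2 + b ^ 2) + (2 * (ε n * a) + 2 * (ε n * b)) + 2 * ε n ^ 2 := by ring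
      _ ≤ (σ + ε n) ^ 2 + (2 * (ε n * (σ + ε n)) + 2 * (ε n * (σ + ε n))) + 2 * ε n ^ 2 := by
          gcongr
      _ = _ := by ring
  · have h1 : Tendsto (fun n => σ + ε n) atTop (𝓝 σ) := by
      simpa using (tendsto_const_nhds (x := σ)).add hε
    have h2 := ENNReal.Tendsto.const_mul (a := 4)
      (ENNReal.Tendsto.mul hε (Or.inr hσt) h1 (Or.inr ENNReal.zero_ne_top)) (Or.inr (by simp))
    have h3 := ENNReal.Tendsto.const_mul (a := 2) (ENNReal.Tendsto.pow (n := 2) hε)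
      (Or.inr (by simp))
    simpa using ((ENNReal.Tendsto.pow (n := 2) h1).add h2).add h3

lemma IsQuasicentralUnit.hsNorm_comm_trunc_le {R R' : ℕ} (h : R ≤ R') (x : L2 Ω →L[ℂ] L2 Ω) :
    hsNorm (comm (trunc Ω R') x - comm (trunc Ω R) x) ^ 2 + hsNorm (comm (trunc Ω R) x) ^ 2 ≤
      hsNorm (comm (trunc Ω R') x) ^ 2 := by
  rw [← comm_sub_left]
  refine hA.hsNorm_comm_le (u := fun _ => trunc Ω R') (trunc_sub_mem_lipBall Ω h)
    (trunc_mem_lipBall Ω R) (fun _ => trunc_mem_lipBall Ω R') ?_ x (fun _ => le_rfl)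
  simp_rw [liminf_const]
  exact trunc_increment Ω h

/-- `L(T)` is computed on the truncated coordinate functions. -/
lemma IsQuasicentralUnit.lipNorm_le (m : ℕ) (y : L2 Ω →L[ℂ] L2 Ω) {σ : ℝ≥0∞}
    (hσ : ∀ n, hsNorm (comm (trunc Ω (m + n)) y) ≤ σ) : lipNorm y ≤ σ := by
  refine iSup₂_le fun f hf => ?_
  refine (ENNReal.pow_le_pow_left_iff two_ne_zero).1 (le_trans le_self_add
    (hA.hsNorm_comm_le hf zero_mem_lipBall (fun n => trunc_mem_lipBall Ω (m + n)) ?_ y hσ))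
  filter_upwards [enorm_sub_le_of_mem_lipBall hf, trunc_eventually_eq Ω m,
    Lp.coeFn_zero ℂ ∞ (leb Ω)] with s h1 h2 h3
  filter_upwards [h1, h2, Lp.coeFn_zero ℂ ∞ (leb Ω)] with t h4 h5 h6
  have : Tendsto (fun n => ‖trunc Ω (m + n) s - trunc Ω (m + n) t‖ₑ ^ 2) atTop
      (𝓝 (‖s - t‖ₑ ^ 2)) :=
    tendsto_const_nhds.congr' (h5.mono fun n hn => congrArg (‖·‖ₑ ^ 2) hn.symm)
  rw [this.liminf_eq, h3, h6]
  simpa using pow_le_pow_left' h4 2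

/-- The commutators of `x ∈ EΛ(Ω)` with the truncated coordinate functions are Cauchy in the
Hilbert--Schmidt norm, because their norms increase to a finite limit. -/
lemma IsQuasicentralUnit.exists_hsNorm_comm_trunc_sub_le {x : L2 Ω →L[ℂ] L2 Ω}
    (hx : lipNorm x < ∞) {δ : ℝ≥0∞} (hδ : δ ≠ 0) : ∃ m : ℕ, ∀ n : ℕ,
      hsNorm (comm (trunc Ω (m + n)) x - comm (trunc Ω m) x) ≤ δ := by
  set β : ℕ → ℝ≥0∞ := fun R => hsNorm (comm (trunc Ω R) x) ^ 2
  have hβ : ∀ R, β R ≤ lipNorm x ^ 2 := fun R =>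
    pow_le_pow_left' (le_lipNorm (trunc_mem_lipBall Ω R) x) 2
  have hmono : Monotone β := fun R R' h => le_add_self.trans (hA.hsNorm_comm_trunc_le h x)
  have hsup : ⨆ R, β R ≠ ∞ := ((iSup_le hβ).trans_lt (ENNReal.pow_lt_top hx)).ne
  have hlim := (tendsto_atTop_iSup hmono).add (tendsto_const_nhds (x := δ ^ 2))
  obtain ⟨m, hm⟩ := (hlim.eventually_const_lt
    (ENNReal.lt_add_right hsup (pow_ne_zero 2 hδ))).exists
  refine ⟨m, fun n => (ENNReal.pow_le_pow_left_iff two_ne_zero).1 ?_⟩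
  have h1 := (hA.hsNorm_comm_trunc_le (Nat.le_add_right m n) x).trans
    ((le_iSup β (m + n)).trans hm.le)
  rw [add_comm (β m)] at h1
  exact (ENNReal.add_le_add_iff_right ((hβ m).trans_lt (ENNReal.pow_lt_top hx)).ne).1 h1

/-- Removing the compact part `A n * x` of `x ∈ EΛ(Ω)` makes `L` tend to `0`. -/
lemma IsQuasicentralUnit.tendsto_lipNorm_one_sub_mul {x : L2 Ω →L[ℂ] L2 Ω}
    (hx : lipNorm x < ∞) : Tendsto (fun n => lipNorm ((1 - A n) * x)) atTop (𝓝 0) := by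
  rw [ENNReal.tendsto_nhds_zero]
  intro ε hε
  have hδ : ε / 3 ≠ 0 := (ENNReal.div_pos hε.ne' (by simp)).ne'
  obtain ⟨m, hm⟩ := hA.exists_hsNorm_comm_trunc_sub_le hx hδ
  have hHS : hsNorm (comm (trunc Ω m) x) ≠ ∞ :=
    ((le_lipNorm (trunc_mem_lipBall Ω m) x).trans_lt hx).ne
  filter_upwards [ENNReal.tendsto_nhds_zero.1 (hA.tendsto_lipNorm_mul x) _
      (pos_iff_ne_zero.2 hδ),
    ENNReal.tendsto_nhds_zero.1 (tendsto_hsNorm_mul hA.norm_one_sub_le hA.one_sub_tendsto hHS) _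
      (pos_iff_ne_zero.2 hδ)] with n h1 h2
  refine hA.lipNorm_le m _ fun k => ?_
  -- The first term is small uniformly in `k` by the Cauchy property, the second does not depend on
  -- `k`, and the third is bounded by `L(A n) ‖x‖`.
  have hdec : comm (trunc Ω (m + k)) ((1 - A n) * x) =
      ((1 - A n) * (comm (trunc Ω (m + k)) x - comm (trunc Ω m) x)
        + (1 - A n) * comm (trunc Ω m) x) - comm (trunc Ω (m + k)) (A n) * x := by
    rw [comm_mul, comm_one_sub]
    noncomm_ring
  rw [hdec]
  refine (hsNorm_sub_le _ _).trans ?_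
  rw [← ENNReal.add_thirds ε]
  refine add_le_add ((hsNorm_add_le _ _).trans (add_le_add ?_ h2)) ?_
  · refine (hsNorm_mul_le_left _ _).trans ?_
    refine (mul_le_mul' ?_ (hm k)).trans_eq (one_mul _)
    rw [← ofReal_norm]
    exact ENNReal.ofReal_le_one.2 (hA.norm_one_sub_le n)
  · exact ((hsNorm_mul_le_right _ _).trans
      (mul_le_mul' (le_lipNorm (trunc_mem_lipBall Ω _) (A n)) le_rfl)).trans h1

end Quasicentral

/-! ### Dyadic squares and the projections onto step functions -/

section Cells

/-- The index of the dyadic square of side `2⁻ᵏ` containing `z`. -/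
def cellOf (k : ℕ) (z : ℂ) : ℤ × ℤ := (⌊2 ^ k * z.re⌋, ⌊2 ^ k * z.im⌋)

/-- The dyadic square of side `2⁻ᵏ` with index `q`. -/
def cell (k : ℕ) (q : ℤ × ℤ) : Set ℂ := {z | cellOf k z = q}

/-- The indices of the dyadic squares of side `2⁻ᵏ` contained in `[-R, R)²`. -/
def boxIdx (R k : ℕ) : Finset (ℤ × ℤ) :=
  Finset.Ico (-(R * 2 ^ k : ℤ)) (R * 2 ^ k) ×ˢ Finset.Ico (-(R * 2 ^ k : ℤ)) (R * 2 ^ k)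

lemma card_boxIdx (R k : ℕ) : (boxIdx R k).card = 4 * R ^ 2 * 4 ^ k := by
  rw [boxIdx, Finset.card_product, Int.card_Ico]
  have : ((R * 2 ^ k : ℤ) - -(R * 2 ^ k)).toNat = 2 * R * 2 ^ k := by
    have : ((R * 2 ^ k : ℤ) - -(R * 2 ^ k)) = ((2 * R * 2 ^ k : ℕ) : ℤ) := by push_cast; ring
    rw [this, Int.toNat_natCast]
  rw [this, show 4 = 2 ^ 2 by norm_num, ← pow_mul, mul_comm 2 k, pow_mul]
  ring

lemma measurable_cellOf (k : ℕ) : Measurable (cellOf k) := by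
  unfold cellOf
  fun_prop

lemma measurableSet_cell (k : ℕ) (q : ℤ × ℤ) : MeasurableSet (cell k q) :=
  measurable_cellOf k (measurableSet_singleton q)

/-- Dyadic squares are nested. -/
lemma cellOf_eq_of_le {k l : ℕ} (h : k ≤ l) {s t : ℂ} (hst : cellOf l s = cellOf l t) :
    cellOf k s = cellOf k t := by
  have key : ∀ x : ℝ, ⌊2 ^ k * x⌋ = ⌊2 ^ l * x⌋ / ((2 ^ (l - k) : ℕ) : ℤ) := by
    intro x
    rw [← Int.floor_div_natCast]
    congr 1
    rw [← Nat.sub_add_cancel h, pow_add, Nat.add_sub_cancel]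
    push_cast
    field_simp
  simp only [cellOf, Prod.mk.injEq] at hst ⊢
  rw [key, key, key, key, hst.1, hst.2]
  exact ⟨rfl, rfl⟩

lemma norm_sub_sq_le_of_cellOf_eq {k : ℕ} {s t : ℂ} (h : cellOf k s = cellOf k t) :
    ‖s - t‖ ^ 2 ≤ 2 * (1 / 4) ^ k := by
  have key : ∀ x y : ℝ, ⌊2 ^ k * x⌋ = ⌊2 ^ k * y⌋ → (x - y) ^ 2 ≤ (1 / 4) ^ k := by
    intro x y hxy
    have h1 := Int.abs_sub_lt_one_of_floor_eq_floor hxy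
    rw [← mul_sub] at h1
    have h2 : (2 ^ k * (x - y)) ^ 2 ≤ 1 := by
      rw [sq_le_one_iff_abs_le_one]
      exact h1.le
    have h3 : (4 : ℝ) ^ k * (1 / 4) ^ k = 1 := by
      rw [← mul_pow]
      norm_num
    have h4 : (2 ^ k : ℝ) ^ 2 = 4 ^ k := by
      rw [← pow_mul, mul_comm, pow_mul]
      norm_num
    rw [mul_pow, h4] at h2
    calc (x - y) ^ 2 = (4 ^ k * (x - y) ^ 2) * (1 / 4) ^ k := by
          rw [mul_right_comm, h3, one_mul]
      _ ≤ 1 * (1 / 4) ^ k := by gcongr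
      _ = _ := one_mul _
  simp only [cellOf, Prod.mk.injEq] at h
  rw [norm_sq_eq, Complex.sub_re, Complex.sub_im]
  linarith [key _ _ h.1, key _ _ h.2]

lemma enorm_sub_sq_le_of_cellOf_eq {k : ℕ} {s t : ℂ} (h : cellOf k s = cellOf k t) :
    ‖s - t‖ₑ ^ 2 ≤ 2 * 4⁻¹ ^ k := by
  rw [← ofReal_norm, ← ENNReal.ofReal_pow (norm_nonneg _)]
  refine (ENNReal.ofReal_le_ofReal (norm_sub_sq_le_of_cellOf_eq h)).trans_eq ?_
  rw [ENNReal.ofReal_mul (by norm_num), ENNReal.ofReal_pow (by norm_num), one_div,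
    ENNReal.ofReal_inv_of_pos (by norm_num)]
  norm_num

lemma dist_le_two_of_cellOf_eq {k : ℕ} {s t : ℂ} (h : cellOf k s = cellOf k t) :
    dist s t ≤ 2 := by
  have h1 := norm_sub_sq_le_of_cellOf_eq h
  have h2 : (1 / 4 : ℝ) ^ k ≤ 1 := pow_le_one₀ (by norm_num) (by norm_num)
  rw [dist_eq_norm]
  nlinarith [norm_nonneg (s - t)]

variable (Ω : Set ℂ)

lemma leb_cell_lt_top (k : ℕ) (q : ℤ × ℤ) : leb Ω (cell k q) < ∞ := by
  refine (Measure.restrict_apply_le _ _).trans_lt ?_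
  rcases (cell k q).eq_empty_or_nonempty with h | ⟨t, ht⟩
  · simp [h]
  · refine (measure_mono fun s hs => ?_).trans_lt (measure_closedBall_lt_top (x := t) (r := 2))
    exact dist_le_two_of_cellOf_eq (Eq.trans hs (Eq.symm ht))

/-- The indicator function of a dyadic square, as an element of `L²(Ω)`. -/
def cellVec (k : ℕ) (q : ℤ × ℤ) : L2 Ω :=
  indicatorConstLp 2 (measurableSet_cell k q) (leb_cell_lt_top Ω k q).ne 1

lemma cellVec_coeFn (k : ℕ) (q : ℤ × ℤ) :
    cellVec Ω k q =ᵐ[leb Ω] (cell k q).indicator fun _ => 1 := indicatorConstLp_coeFn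

lemma inner_cellVec (k : ℕ) (q r : ℤ × ℤ) : inner ℂ (cellVec Ω k q) (cellVec Ω k r) =
    if q = r then ((leb Ω).real (cell k q) : ℂ) else 0 := by
  rw [cellVec, cellVec, L2.inner_indicatorConstLp_indicatorConstLp (measurableSet_cell k q)
    (measurableSet_cell k r) (leb_cell_lt_top Ω k q).ne (leb_cell_lt_top Ω k r).ne]
  split_ifs with h
  · subst h
    simp
  · have : cell k q ∩ cell k r = ∅ := by
      ext z
      simp only [cell, Set.mem_inter_iff, Set.mem_ofPred_eq, Set.mem_empty_iff_false, iff_false]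
      rintro ⟨h1, h2⟩
      exact h (h1.symm.trans h2)
    simp [this]

/-- The projection onto the span of the indicator functions of the dyadic squares of side `2⁻ᵏ`
contained in `[-R, R)²`. Squares that meet `Ω` in a null set contribute `0`. -/
def cellProj (R k : ℕ) : L2 Ω →L[ℂ] L2 Ω :=
  ∑ q ∈ boxIdx R k, (((leb Ω).real (cell k q))⁻¹ : ℂ) •
    InnerProductSpace.rankOne ℂ (cellVec Ω k q) (cellVec Ω k q)

lemma cellProj_apply (R k : ℕ) (h : L2 Ω) : cellProj Ω R k h = ∑ q ∈ boxIdx R k,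
    (((leb Ω).real (cell k q))⁻¹ : ℂ) • inner ℂ (cellVec Ω k q) h • cellVec Ω k q := by
  simp [cellProj, sum_apply]

lemma cellProj_cellVec {R k : ℕ} {q : ℤ × ℤ} (hq : q ∈ boxIdx R k) :
    cellProj Ω R k (cellVec Ω k q) = cellVec Ω k q := by
  rw [cellProj_apply, Finset.sum_eq_single_of_mem q hq]
  · rw [inner_cellVec, if_pos rfl, smul_smul]
    -- A square meeting `Ω` in a null set has weight `0⁻¹ = 0`, and its indicator function is `0`.
    rcases eq_or_ne ((leb Ω).real (cell k q)) 0 with h | h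
    · have : cellVec Ω k q = 0 := by
        rw [← inner_self_eq_zero (𝕜 := ℂ), inner_cellVec, if_pos rfl, h, Complex.ofReal_zero]
      rw [this, smul_zero]
    · rw [inv_mul_cancel₀ (by exact_mod_cast h), one_smul]
  · intro r _ hr
    rw [inner_cellVec, if_neg hr, zero_smul, smul_zero]

lemma isStarProjection_cellProj (R k : ℕ) : IsStarProjection (cellProj Ω R k) := by
  constructor
  · refine ContinuousLinearMap.ext fun h => ?_
    change cellProj Ω R k (cellProj Ω R k h) = cellProj Ω R k h
    conv_lhs => rw [cellProj_apply Ω R k h]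
    rw [map_sum, cellProj_apply]
    refine Finset.sum_congr rfl fun q hq => ?_
    rw [map_smul, map_smul, cellProj_cellVec Ω hq]
  · rw [IsSelfAdjoint, cellProj, star_sum]
    refine Finset.sum_congr rfl fun q _ => ?_
    rw [star_smul, ContinuousLinearMap.star_eq_adjoint, InnerProductSpace.adjoint_rankOne]
    simp

lemma norm_cellProj_le (R k : ℕ) : ‖cellProj Ω R k‖ ≤ 1 :=
  (isStarProjection_cellProj Ω R k).norm_le

lemma norm_one_sub_cellProj_le (R k : ℕ) : ‖1 - cellProj Ω R k‖ ≤ 1 :=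
  (isStarProjection_cellProj Ω R k).one_sub.norm_le

lemma isCompactOperator_rankOne (u v : L2 Ω) :
    IsCompactOperator (InnerProductSpace.rankOne ℂ u v) := by
  rw [InnerProductSpace.rankOne_def']
  have : IsCompactOperator (ContinuousLinearMap.toSpanSingleton ℂ u) :=
    isCompactOperator_of_locallyCompactSpace_rng (ContinuousLinearMap.toSpanSingleton ℂ u)
  exact this.comp_clm (innerSL ℂ v)

lemma isCompactOperator_cellProj (R k : ℕ) : IsCompactOperator (cellProj Ω R k) := by
  have : cellProj Ω R k ∈ compactIdeal (L2 Ω) :=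
    Ideal.sum_mem _ fun q _ =>
      (isCompactOperator_rankOne Ω (cellVec Ω k q) (cellVec Ω k q)).smul
        (((leb Ω).real (cell k q))⁻¹ : ℂ)
  exact this

end Cells

/-! ### Almost orthogonality of commutators with dyadic projections -/

section Kernel

variable {Ω : Set ℂ}

lemma hasKernel_rankOne (u v : L2 Ω) :
    HasKernel (InnerProductSpace.rankOne ℂ u v) fun s => star (u s) • v := by
  intro b
  rw [InnerProductSpace.rankOne_apply]
  filter_upwards [Lp.coeFn_smul (inner ℂ v b) u] with s hs
  rw [hs, Pi.smul_apply, inner_smul_left, smul_eq_mul, mul_comm]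
  simp

lemma HasKernel.smul {T : L2 Ω →L[ℂ] L2 Ω} {w : ℂ → L2 Ω} (h : HasKernel T w) (c : ℂ) :
    HasKernel (c • T) fun s => star c • w s := by
  intro b
  rw [smul_apply]
  filter_upwards [Lp.coeFn_smul c (T b), h b] with s h1 h2
  rw [h1, Pi.smul_apply, h2, inner_smul_left]
  simp

lemma HasKernel.sum {ι : Type*} (S : Finset ι) {T : ι → L2 Ω →L[ℂ] L2 Ω} {w : ι → ℂ → L2 Ω}
    (h : ∀ i ∈ S, HasKernel (T i) (w i)) : HasKernel (∑ i ∈ S, T i) fun s => ∑ i ∈ S, w i s := by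
  intro b
  rw [sum_apply]
  have h2 := (ae_ball_iff S.countable_toSet).2 fun i hi => h i hi b
  filter_upwards [Lp.coeFn_finsetSum S fun i => T i b, h2] with s h1 h2
  rw [h1, sum_inner, Finset.sum_apply]
  exact Finset.sum_congr rfl fun i hi => h2 i hi

variable (Ω)

/-- The weight of a dyadic square in the kernel of `cellProj`: the inverse of the measure of its
intersection with `Ω`, or `0` if that is a null set. -/
def cellWeight (k : ℕ) (q : ℤ × ℤ) : ℝ≥0∞ := ENNReal.ofReal ((leb Ω).real (cell k q))⁻¹

lemma cellWeight_mul_le (k : ℕ) (q : ℤ × ℤ) : cellWeight Ω k q * leb Ω (cell k q) ≤ 1 := by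
  rw [cellWeight, ← ENNReal.ofReal_toReal (leb_cell_lt_top Ω k q).ne, ← measureReal_def,
    ← ENNReal.ofReal_mul (by positivity)]
  exact ENNReal.ofReal_le_one.2 inv_mul_le_one

/-- The kernel of `cellProj`, with values in `[0, ∞]`. -/
def cellKer (R k : ℕ) (s t : ℂ) : ℝ≥0∞ :=
  ∑ q ∈ boxIdx R k, cellWeight Ω k q * ((cell k q).indicator 1 s * (cell k q).indicator 1 t)

/-- The kernel of `cellProj` is dominated by `cellKer`. -/
lemma exists_hasKernel_cellProj (R k : ℕ) : ∃ w, HasKernel (cellProj Ω R k) w ∧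
    ∀ᵐ s ∂leb Ω, ∀ᵐ t ∂leb Ω, ‖w s t‖ₑ ≤ cellKer Ω R k s t := by
  refine ⟨_, HasKernel.sum _ fun q _ => (hasKernel_rankOne _ _).smul _, ?_⟩
  have hv := ae_all_iff.2 fun q => cellVec_coeFn Ω k q
  have he : ∀ (q : ℤ × ℤ) (z : ℂ), ‖(cell k q).indicator (fun _ => (1 : ℂ)) z‖ₑ =
      (cell k q).indicator 1 z := by
    intro q z
    by_cases h : z ∈ cell k q <;> simp [h]
  filter_upwards [hv] with s hs
  have hc := ae_all_iff.2 fun q => Lp.coeFn_smul (star (((leb Ω).real (cell k q))⁻¹ : ℂ))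
    (star (cellVec Ω k q s) • cellVec Ω k q)
  have hc' := ae_all_iff.2 fun q => Lp.coeFn_smul (star (cellVec Ω k q s)) (cellVec Ω k q)
  filter_upwards [hv, hc, hc', Lp.coeFn_finsetSum (boxIdx R k) fun q =>
    star (((leb Ω).real (cell k q))⁻¹ : ℂ) • star (cellVec Ω k q s) • cellVec Ω k q]
    with t ht h1 h2 h3
  rw [h3, Finset.sum_apply]
  refine (enorm_sum_le _ _).trans_eq (Finset.sum_congr rfl fun q _ => ?_)
  rw [h1, Pi.smul_apply, h2, Pi.smul_apply, smul_eq_mul, smul_eq_mul, enorm_mul, enorm_mul, hs, ht,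
    he]
  congr 1
  · rw [cellWeight, ← ofReal_norm, norm_star, norm_inv, Complex.norm_real, Real.norm_eq_abs,
      abs_of_nonneg measureReal_nonneg]
  · congr 1
    rw [← he, ← ofReal_norm, norm_star, ofReal_norm]

lemma measurable_cellKer_right (R k : ℕ) (s : ℂ) : Measurable (cellKer Ω R k s) := by
  unfold cellKer
  have : ∀ q, Measurable ((cell k q).indicator (1 : ℂ → ℝ≥0∞)) := fun q =>
    measurable_one.indicator (measurableSet_cell k q)
  fun_prop

lemma cellKer_congr_right (R : ℕ) {k : ℕ} (s : ℂ) {t t' : ℂ} (h : cellOf k t = cellOf k t') :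
    cellKer Ω R k s t = cellKer Ω R k s t' := by
  have : ∀ q, (cell k q).indicator (1 : ℂ → ℝ≥0∞) t = (cell k q).indicator 1 t' := by
    intro q
    have hq : t ∈ cell k q ↔ t' ∈ cell k q := by simp only [cell, Set.mem_ofPred_eq, h]
    by_cases ht : t' ∈ cell k q <;> simp [hq, ht]
  simp only [cellKer, this]

lemma cellKer_eq_zero (R : ℕ) {k : ℕ} {s t : ℂ} (h : cellOf k s ≠ cellOf k t) :
    cellKer Ω R k s t = 0 := by
  refine Finset.sum_eq_zero fun q _ => ?_
  by_cases h1 : s ∈ cell k q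
  · have h2 : t ∉ cell k q := fun h2 => h (Eq.trans h1 (Eq.symm h2))
    simp [h2]
  · simp [h1]

lemma lintegral_cellKer_le (R k : ℕ) (s : ℂ) : ∫⁻ t, cellKer Ω R k s t ∂leb Ω ≤ 1 := by
  unfold cellKer
  have hm : ∀ q, Measurable ((cell k q).indicator (1 : ℂ → ℝ≥0∞)) := fun q =>
    measurable_one.indicator (measurableSet_cell k q)
  rw [lintegral_finsetSum _ fun q _ => by fun_prop]
  calc _ ≤ ∑ q ∈ boxIdx R k, (cell k q).indicator (1 : ℂ → ℝ≥0∞) s := by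
        refine Finset.sum_le_sum fun q _ => ?_
        simp_rw [mul_left_comm (cellWeight Ω k q)]
        rw [lintegral_const_mul _ (by fun_prop), lintegral_const_mul _ (by fun_prop),
          lintegral_indicator_one (measurableSet_cell k q)]
        exact mul_le_of_le_one_right' (cellWeight_mul_le Ω k q)
    _ = ∑ q ∈ boxIdx R k, if cellOf k s = q then 1 else 0 := by
        refine Finset.sum_congr rfl fun q _ => ?_
        by_cases h : cellOf k s = q <;> simp [cell, h]
    _ ≤ 1 := by
        rw [Finset.sum_ite_eq]
        split_ifs <;> simp

/-- The trace of `cellProj` is at most the number of squares. -/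
lemma lintegral_cellKer_diag_le (R k : ℕ) :
    ∫⁻ s, cellKer Ω R k s s ∂leb Ω ≤ 4 * R ^ 2 * 4 ^ k := by
  unfold cellKer
  have hm : ∀ q, Measurable ((cell k q).indicator (1 : ℂ → ℝ≥0∞)) := fun q =>
    measurable_one.indicator (measurableSet_cell k q)
  rw [lintegral_finsetSum _ fun q _ => by fun_prop]
  calc _ ≤ ∑ q ∈ boxIdx R k, (1 : ℝ≥0∞) := by
        refine Finset.sum_le_sum fun q _ => ?_
        have : ∀ s, (cell k q).indicator (1 : ℂ → ℝ≥0∞) s * (cell k q).indicator 1 s =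
            (cell k q).indicator 1 s := by
          intro s
          by_cases h : s ∈ cell k q <;> simp [h]
        simp_rw [this]
        rw [lintegral_const_mul _ (hm q), lintegral_indicator_one (measurableSet_cell k q)]
        exact cellWeight_mul_le Ω k q
    _ = _ := by
        rw [Finset.sum_const, card_boxIdx]
        simp

lemma measurable_cellKer_diag (R k : ℕ) : Measurable fun s => cellKer Ω R k s s := by
  unfold cellKer
  have : ∀ q, Measurable ((cell k q).indicator (1 : ℂ → ℝ≥0∞)) := fun q =>
    measurable_one.indicator (measurableSet_cell k q)
  fun_prop

/-- Almost orthogonality of the commutators of the coordinate function with the dyadic projections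
of different levels. The kernel of the finer projection localizes to its own squares, on which the
coarser kernel is constant. -/
lemma lintegral_cellKer_mul_le (R : ℕ) {k l : ℕ} (h : k ≤ l) :
    ∫⁻ s, ∫⁻ t, ‖s - t‖ₑ ^ 2 * (cellKer Ω R k s t * cellKer Ω R l s t) ∂leb Ω ∂leb Ω ≤
      8 * R ^ 2 * 4⁻¹ ^ (l - k) := by
  calc _ ≤ ∫⁻ s, ∫⁻ t, (2 * 4⁻¹ ^ l * cellKer Ω R k s s) * cellKer Ω R l s t ∂leb Ω ∂leb Ω := by
        refine lintegral_mono fun s => lintegral_mono fun t => ?_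
        by_cases hst : cellOf l s = cellOf l t
        · rw [← mul_assoc, cellKer_congr_right Ω R s (cellOf_eq_of_le h hst)]
          gcongr
          exact enorm_sub_sq_le_of_cellOf_eq hst
        · rw [cellKer_eq_zero Ω R hst]
          simp
    _ ≤ ∫⁻ s, 2 * 4⁻¹ ^ l * cellKer Ω R k s s ∂leb Ω := by
        refine lintegral_mono fun s => ?_
        simp only
        rw [lintegral_const_mul _ (measurable_cellKer_right Ω R l s)]
        exact mul_le_of_le_one_right' (lintegral_cellKer_le Ω R l s)
    _ ≤ 2 * 4⁻¹ ^ l * (4 * R ^ 2 * 4 ^ k) := by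
        rw [lintegral_const_mul _ (measurable_cellKer_diag Ω R k)]
        gcongr
        exact lintegral_cellKer_diag_le Ω R k
    _ = _ := by
        obtain ⟨d, rfl⟩ := Nat.exists_eq_add_of_le h
        have h4 : (4⁻¹ : ℝ≥0∞) ^ k * 4 ^ k = 1 := by
          rw [← mul_pow, ENNReal.inv_mul_cancel (by simp) (by simp), one_pow]
        rw [Nat.add_sub_cancel_left, pow_add]
        calc _ = 8 * R ^ 2 * 4⁻¹ ^ d * ((4⁻¹ : ℝ≥0∞) ^ k * 4 ^ k) := by ring
          _ = _ := by rw [h4, mul_one]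

end Kernel

/-! ### Averages of dyadic projections -/

section Averages

variable (Ω : Set ℂ)

/-- The average of the projections `cellProj` over `N` consecutive dyadic levels. -/
def avgProj (R m N : ℕ) : L2 Ω →L[ℂ] L2 Ω :=
  (N : ℂ)⁻¹ • ∑ j ∈ Finset.range N, cellProj Ω R (m + j)

lemma isCompactOperator_avgProj (R m N : ℕ) : IsCompactOperator (avgProj Ω R m N) := by
  have : ∑ j ∈ Finset.range N, cellProj Ω R (m + j) ∈ compactIdeal (L2 Ω) :=
    Ideal.sum_mem _ fun j _ => isCompactOperator_cellProj Ω R (m + j)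
  exact IsCompactOperator.smul this ((N : ℂ)⁻¹)

lemma norm_inv_smul_sum_le {E : Type*} [NormedAddCommGroup E] [NormedSpace ℂ E] {N : ℕ}
    (hN : N ≠ 0) (T : ℕ → E) {c : ℝ} (hT : ∀ j < N, ‖T j‖ ≤ c) :
    ‖(N : ℂ)⁻¹ • ∑ j ∈ Finset.range N, T j‖ ≤ c := by
  have h1 : ‖∑ j ∈ Finset.range N, T j‖ ≤ N * c := by
    refine (norm_sum_le_of_le _ fun j hj => hT j (Finset.mem_range.1 hj)).trans_eq ?_
    simp
  rw [norm_smul, norm_inv, Complex.norm_natCast]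
  have h2 : (0 : ℝ) < N := by positivity
  calc _ ≤ (N : ℝ)⁻¹ * (N * c) := by gcongr
    _ = c := by field_simp

lemma one_sub_avgProj {N : ℕ} (hN : N ≠ 0) (R m : ℕ) : 1 - avgProj Ω R m N =
    (N : ℂ)⁻¹ • ∑ j ∈ Finset.range N, (1 - cellProj Ω R (m + j)) := by
  rw [Finset.sum_sub_distrib, smul_sub, avgProj, Finset.sum_const, Finset.card_range,
    ← Nat.cast_smul_eq_nsmul ℂ, smul_smul, inv_mul_cancel₀ (by exact_mod_cast hN), one_smul]

lemma norm_one_sub_avgProj_apply_le {R m N : ℕ} (hN : N ≠ 0) (h : L2 Ω) {c : ℝ}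
    (hc : ∀ j < N, ‖(1 - cellProj Ω R (m + j)) h‖ ≤ c) : ‖(1 - avgProj Ω R m N) h‖ ≤ c := by
  rw [one_sub_avgProj Ω hN, smul_apply, sum_apply]
  exact norm_inv_smul_sum_le hN (fun j => (1 - cellProj Ω R (m + j)) h) hc

/-- The square of a sum is bounded by twice its part on and below the diagonal. -/
lemma sq_sum_range_le (a : ℕ → ℝ≥0∞) (N : ℕ) : (∑ j ∈ Finset.range N, a j) ^ 2 ≤
    2 * ∑ j ∈ Finset.range N, ∑ i ∈ Finset.range (j + 1), a i * a j := by
  induction N with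
  | zero => simp
  | succ N ih =>
    rw [Finset.sum_range_succ (n := N), Finset.sum_range_succ (n := N), mul_add,
      ← Finset.sum_mul (Finset.range (N + 1)), Finset.sum_range_succ (n := N)]
    set S := ∑ j ∈ Finset.range N, a j
    calc (S + a N) ^ 2 = S ^ 2 + (2 * (S * a N) + a N * a N) := by ring
      _ ≤ S ^ 2 + (2 * (S * a N) + 2 * (a N * a N)) := by
          refine add_le_add le_rfl (add_le_add le_rfl ?_)
          rw [two_mul]
          exact le_self_add
      _ ≤ _ := by
          refine (add_le_add ih le_rfl).trans_eq ?_
          ring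

lemma sum_inv_four_pow_le (j : ℕ) :
    ∑ i ∈ Finset.range (j + 1), (4⁻¹ : ℝ≥0∞) ^ (j - i) ≤ 2 := by
  have h := Finset.sum_range_reflect (fun i => (4⁻¹ : ℝ≥0∞) ^ i) (j + 1)
  simp only [Nat.add_sub_cancel] at h
  rw [h]
  refine (ENNReal.sum_le_tsum _).trans ?_
  rw [ENNReal.tsum_geometric]
  calc (1 - 4⁻¹ : ℝ≥0∞)⁻¹ ≤ (1 - 2⁻¹)⁻¹ := by
        gcongr
        norm_num
    _ = 2 := by rw [ENNReal.one_sub_inv_two, inv_inv]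

lemma measurable_uncurry_cellKer (R k : ℕ) :
    Measurable fun p : ℂ × ℂ => cellKer Ω R k p.1 p.2 := by
  unfold cellKer
  have hm : ∀ q, Measurable ((cell k q).indicator (1 : ℂ → ℝ≥0∞)) := fun q =>
    measurable_one.indicator (measurableSet_cell k q)
  fun_prop

/-- By almost orthogonality, averaging over `N` levels gains a factor `N`. -/
lemma lintegral_sq_sum_cellKer_le (R m N : ℕ) :
    ∫⁻ s, ∫⁻ t, ‖s - t‖ₑ ^ 2 * (∑ j ∈ Finset.range N, cellKer Ω R (m + j) s t) ^ 2
      ∂leb Ω ∂leb Ω ≤ 32 * R ^ 2 * N := by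
  set F : ℕ → ℕ → ℂ → ℂ → ℝ≥0∞ := fun i j s t =>
    ‖s - t‖ₑ ^ 2 * (cellKer Ω R (m + i) s t * cellKer Ω R (m + j) s t)
  have hF : ∀ i j, Measurable fun p : ℂ × ℂ => F i j p.1 p.2 := by
    intro i j
    have h1 := measurable_uncurry_cellKer Ω R (m + i)
    have h2 := measurable_uncurry_cellKer Ω R (m + j)
    simp only [F]
    fun_prop
  have hF1 : ∀ i j s, Measurable (F i j s) := by
    intro i j s
    have h1 := measurable_cellKer_right Ω R (m + i) s
    have h2 := measurable_cellKer_right Ω R (m + j) s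
    simp only [F]
    fun_prop
  have hF2 : ∀ i j, Measurable fun s => ∫⁻ t, F i j s t ∂leb Ω := fun i j =>
    (hF i j).lintegral_prod_right'
  calc _ ≤ ∫⁻ s, ∫⁻ t, 2 * ∑ j ∈ Finset.range N, ∑ i ∈ Finset.range (j + 1), F i j s t
        ∂leb Ω ∂leb Ω := by
        refine lintegral_mono fun s => lintegral_mono fun t => ?_
        refine (mul_le_mul_right (sq_sum_range_le _ N) _).trans_eq ?_
        rw [mul_left_comm]
        simp_rw [Finset.mul_sum]
        rfl
    _ = 2 * ∑ j ∈ Finset.range N, ∑ i ∈ Finset.range (j + 1),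
        ∫⁻ s, ∫⁻ t, F i j s t ∂leb Ω ∂leb Ω := by
        have h1 : ∀ s, ∫⁻ t, 2 * ∑ j ∈ Finset.range N, ∑ i ∈ Finset.range (j + 1), F i j s t
            ∂leb Ω = 2 * ∑ j ∈ Finset.range N, ∑ i ∈ Finset.range (j + 1),
              ∫⁻ t, F i j s t ∂leb Ω := by
          intro s
          rw [lintegral_const_mul _ (by fun_prop), lintegral_finsetSum _ fun j _ => by fun_prop]
          congr 1
          exact Finset.sum_congr rfl fun j _ => lintegral_finsetSum _ fun i _ => hF1 i j s
        simp_rw [h1]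
        rw [lintegral_const_mul _ (by fun_prop), lintegral_finsetSum _ fun j _ => by fun_prop]
        congr 1
        exact Finset.sum_congr rfl fun j _ => lintegral_finsetSum _ fun i _ => hF2 i j
    _ ≤ 2 * ∑ j ∈ Finset.range N, 8 * (R : ℝ≥0∞) ^ 2 * 2 := by
        gcongr with j hj
        calc _ ≤ ∑ i ∈ Finset.range (j + 1), 8 * (R : ℝ≥0∞) ^ 2 * 4⁻¹ ^ (j - i) := by
              refine Finset.sum_le_sum fun i hi => ?_
              have hij : i ≤ j := Nat.lt_succ_iff.1 (Finset.mem_range.1 hi)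
              have h := lintegral_cellKer_mul_le Ω R (Nat.add_le_add_left hij m)
              rw [Nat.add_sub_add_left] at h
              exact h
          _ ≤ 8 * (R : ℝ≥0∞) ^ 2 * 2 := by
              rw [← Finset.mul_sum]
              exact mul_le_mul_right (sum_inv_four_pow_le j) _
    _ = _ := by
        rw [Finset.sum_const, Finset.card_range, nsmul_eq_mul]
        ring

lemma hsNorm_comm_avgProj_sq_le (R m N : ℕ) {f : Linf Ω} (hf : f ∈ lipBall Ω) :
    hsNorm (comm f (avgProj Ω R m N)) ^ 2 ≤ (N : ℝ≥0∞)⁻¹ ^ 2 * (32 * R ^ 2 * N) := by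
  choose w hw hb using fun j => exists_hasKernel_cellProj Ω R (m + j)
  have hk : HasKernel (avgProj Ω R m N) _ :=
    (HasKernel.sum (Finset.range N) fun j _ => hw j).smul (N : ℂ)⁻¹
  rw [hk.hsNorm_comm_sq]
  have hM : Measurable fun p : ℂ × ℂ => ‖p.1 - p.2‖ₑ ^ 2 *
      (∑ j ∈ Finset.range N, cellKer Ω R (m + j) p.1 p.2) ^ 2 := by
    refine Measurable.mul (by fun_prop) (Measurable.pow_const ?_ 2)
    exact Finset.measurable_fun_sum _ fun j _ => measurable_uncurry_cellKer Ω R (m + j)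
  have hM1 : ∀ s, Measurable fun t => ‖s - t‖ₑ ^ 2 *
      (∑ j ∈ Finset.range N, cellKer Ω R (m + j) s t) ^ 2 := by
    intro s
    refine Measurable.mul (by fun_prop) (Measurable.pow_const ?_ 2)
    exact Finset.measurable_fun_sum _ fun j _ => measurable_cellKer_right Ω R (m + j) s
  have hle := mul_le_mul_right (lintegral_sq_sum_cellKer_le Ω R m N) ((N : ℝ≥0∞)⁻¹ ^ 2)
  refine le_trans ?_ hle
  rw [← lintegral_const_mul _ hM.lintegral_prod_right']
  refine lintegral_mono_ae ?_
  filter_upwards [ae_all_iff.2 hb, enorm_sub_le_of_mem_lipBall hf] with s h1 h2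
  rw [← lintegral_const_mul _ (hM1 s)]
  refine lintegral_mono_ae ?_
  filter_upwards [ae_all_iff.2 h1, h2,
    Lp.coeFn_smul (star (N : ℂ)⁻¹) (∑ j ∈ Finset.range N, w j s),
    Lp.coeFn_finsetSum (Finset.range N) fun j => w j s] with t h3 h4 h5 h6
  rw [h5, Pi.smul_apply, h6, Finset.sum_apply, smul_eq_mul, enorm_mul, mul_left_comm, mul_pow]
  have h7 : ‖star (N : ℂ)⁻¹‖ₑ ≤ (N : ℝ≥0∞)⁻¹ := by
    rcases eq_or_ne N 0 with rfl | hN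
    · simp
    · have hN' : (0 : ℝ) < N := by positivity
      rw [← ofReal_norm, norm_star, norm_inv, Complex.norm_natCast, ENNReal.ofReal_inv_of_pos hN',
        ENNReal.ofReal_natCast]
  gcongr
  exact (enorm_sum_le _ _).trans (Finset.sum_le_sum fun j _ => h3 j)

end Averages

/-! ### Strong convergence of the averages -/

section StrongConvergence

variable {Ω : Set ℂ}

/-- The lower left corner of a dyadic square. -/
def corner (k : ℕ) (q : ℤ × ℤ) : ℂ := ⟨q.1 / 2 ^ k, q.2 / 2 ^ k⟩

lemma cellOf_corner (k : ℕ) (q : ℤ × ℤ) : cellOf k (corner k q) = q := by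
  have h : ∀ a : ℤ, ⌊(2 : ℝ) ^ k * (a / 2 ^ k)⌋ = a := by
    intro a
    rw [mul_div_cancel₀ _ (by positivity), Int.floor_intCast]
  simp only [cellOf, corner, h]

lemma cellOf_mem_boxIdx {R k : ℕ} {z : ℂ} (hz : ‖z‖ < R) : cellOf k z ∈ boxIdx R k := by
  have key : ∀ x : ℝ, |x| < R → -(R * 2 ^ k : ℤ) ≤ ⌊2 ^ k * x⌋ ∧ ⌊2 ^ k * x⌋ < (R * 2 ^ k : ℤ) := by
    intro x hx
    rw [abs_lt] at hx
    have h2 : (0 : ℝ) < 2 ^ k := by positivity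
    rw [Int.le_floor, Int.floor_lt]
    push_cast
    constructor <;> nlinarith
  simp only [boxIdx, cellOf, Finset.mem_product, Finset.mem_Ico]
  exact ⟨key _ ((Complex.abs_re_le_norm z).trans_lt hz),
    key _ ((Complex.abs_im_le_norm z).trans_lt hz)⟩

variable (Ω) in
/-- The step function with values `g (corner k q)`. -/
def stepVec (R k : ℕ) (g : ℂ → ℂ) : L2 Ω :=
  ∑ q ∈ boxIdx R k, g (corner k q) • cellVec Ω k q

lemma cellProj_stepVec (R k : ℕ) (g : ℂ → ℂ) :
    cellProj Ω R k (stepVec Ω R k g) = stepVec Ω R k g := by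
  rw [stepVec, map_sum]
  refine Finset.sum_congr rfl fun q hq => ?_
  rw [map_smul, cellProj_cellVec Ω hq]

lemma stepVec_coeFn (R k : ℕ) (g : ℂ → ℂ) : stepVec Ω R k g =ᵐ[leb Ω] fun z =>
    if cellOf k z ∈ boxIdx R k then g (corner k (cellOf k z)) else 0 := by
  filter_upwards [Lp.coeFn_finsetSum (boxIdx R k) fun q => g (corner k q) • cellVec Ω k q,
    ae_all_iff.2 fun q => Lp.coeFn_smul (g (corner k q)) (cellVec Ω k q),
    ae_all_iff.2 fun q => cellVec_coeFn Ω k q] with z h1 h2 h3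
  rw [stepVec, h1, Finset.sum_apply, ← Finset.sum_ite_eq (boxIdx R k) (cellOf k z)
    fun q => g (corner k q)]
  refine Finset.sum_congr rfl fun q _ => ?_
  rw [h2, Pi.smul_apply, h3]
  by_cases h : cellOf k z = q <;> simp [cell, h]

/-- Approximation of a compactly supported continuous function by step functions. -/
lemma exists_eLpNorm_sub_stepVec_le {g : ℂ → ℂ} (hg : Continuous g) (hs : HasCompactSupport g)
    {ε : ℝ} (hε : 0 < ε) : ∃ M : ℕ, ∀ R ≥ M, ∀ k ≥ M,
      eLpNorm (fun z => g z - stepVec Ω R k g z) 2 (leb Ω) ≤ ENNReal.ofReal ε := by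
  obtain ⟨r, hr⟩ := hs.isCompact.isBounded.subset_closedBall 0
  obtain ⟨M₀, hM₀⟩ := exists_nat_ge r
  have hsupp : ∀ z, (M₀ : ℝ) < ‖z‖ → g z = 0 := by
    intro z hz
    by_contra h
    have := hr (subset_tsupport g h)
    rw [mem_closedBall_zero_iff] at this
    linarith
  set B : Set ℂ := Metric.closedBall 0 (M₀ + 2)
  set v : ℝ := ((leb Ω B) ^ (1 / (2 : ℝ≥0∞).toReal)).toReal
  have hBfin : leb Ω B < ∞ :=
    (Measure.restrict_apply_le _ _).trans_lt measure_closedBall_lt_top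
  have hv : (leb Ω B) ^ (1 / (2 : ℝ≥0∞).toReal) = ENNReal.ofReal v :=
    (ENNReal.ofReal_toReal (ENNReal.rpow_ne_top_of_nonneg (by simp) hBfin.ne)).symm
  have hv0 : 0 ≤ v := ENNReal.toReal_nonneg
  set η : ℝ := ε / (v + 1)
  have hη : 0 < η := by positivity
  obtain ⟨δ, hδ, hunif⟩ := Metric.uniformContinuous_iff.1
    (hs.uniformContinuous_of_continuous hg) η hη
  obtain ⟨M₁, hM₁⟩ := exists_pow_lt_of_lt_one (show 0 < δ ^ 2 / 2 by positivity)
    (show (1 / 4 : ℝ) < 1 by norm_num)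
  -- `R ≥ M₀ + 1` because the box `[-R, R)²` is half open and has to contain the support of `g`.
  refine ⟨max (M₀ + 1) M₁, fun R hR k hk => ?_⟩
  have hR : (M₀ : ℝ) < R := by exact_mod_cast (le_of_max_le_left hR)
  have hclose : ∀ z, dist z (corner k (cellOf k z)) < δ := by
    intro z
    have h1 := norm_sub_sq_le_of_cellOf_eq (cellOf_corner k (cellOf k z)).symm
    have h2 : (1 / 4 : ℝ) ^ k ≤ (1 / 4) ^ M₁ :=
      pow_le_pow_of_le_one (by norm_num) (by norm_num) (le_of_max_le_right hk)
    rw [dist_eq_norm]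
    exact lt_of_pow_lt_pow_left₀ 2 hδ.le (by linarith)
  have hpt : ∀ᵐ z ∂leb Ω, ‖g z - stepVec Ω R k g z‖ ≤ ‖B.indicator (fun _ => η) z‖ := by
    filter_upwards [stepVec_coeFn R k g] with z hz
    rw [hz]
    by_cases hzB : z ∈ B
    · rw [Set.indicator_of_mem hzB, Real.norm_of_nonneg hη.le]
      split_ifs with hq
      · rw [← dist_eq_norm]
        exact (hunif (hclose z)).le
      · have : g z = 0 := hsupp z (hR.trans_le (not_lt.1 fun h => hq (cellOf_mem_boxIdx h)))
        rw [this, sub_zero, norm_zero]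
        exact hη.le
    · rw [Set.indicator_of_notMem hzB, norm_zero]
      rw [mem_closedBall_zero_iff, not_le] at hzB
      have h1 : g z = 0 := hsupp z (by linarith)
      have h2 : g (corner k (cellOf k z)) = 0 := by
        refine hsupp _ ?_
        have h3 := dist_le_two_of_cellOf_eq (cellOf_corner k (cellOf k z)).symm
        rw [dist_eq_norm] at h3
        linarith [norm_le_norm_add_norm_sub' z (corner k (cellOf k z))]
      rw [h1, h2]
      simp
  refine (eLpNorm_mono_ae hpt).trans ?_
  rw [eLpNorm_indicator_const Metric.isClosed_closedBall.measurableSet two_ne_zero (by simp), hv,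
    ← ofReal_norm, Real.norm_of_nonneg hη.le, ← ENNReal.ofReal_mul hη.le]
  refine ENNReal.ofReal_le_ofReal ?_
  rw [div_mul_eq_mul_div, div_le_iff₀ (by positivity)]
  nlinarith

lemma exists_norm_one_sub_cellProj_apply_le (hΩ : MeasurableSet Ω) (h : L2 Ω) {ε : ℝ}
    (hε : 0 < ε) : ∃ M : ℕ, ∀ R ≥ M, ∀ k ≥ M, ‖(1 - cellProj Ω R k) h‖ ≤ ε := by
  have hH : MemLp (Ω.indicator h) 2 volume := (memLp_indicator_iff_restrict hΩ).2 (Lp.memLp h)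
  obtain ⟨g, hs, hgε, hg, -⟩ := hH.exists_hasCompactSupport_eLpNorm_sub_le (by simp)
    (ε := ENNReal.ofReal (ε / 2)) (by simpa using hε)
  have hclose : eLpNorm (fun z => h z - g z) 2 (leb Ω) ≤ ENNReal.ofReal (ε / 2) := by
    refine le_trans ?_ hgε
    refine le_trans (le_of_eq (eLpNorm_congr_ae ?_))
      (eLpNorm_mono_measure _ Measure.restrict_le_self)
    filter_upwards [ae_restrict_mem hΩ] with z hz
    simp [hz]
  obtain ⟨M, hM⟩ := exists_eLpNorm_sub_stepVec_le (Ω := Ω) hg hs (half_pos hε)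
  refine ⟨M, fun R hR k hk => ?_⟩
  have hdec : (1 - cellProj Ω R k) h = (1 - cellProj Ω R k) (h - stepVec Ω R k g) := by
    rw [map_sub, sub_apply _ _ (stepVec Ω R k g), cellProj_stepVec]
    simp
  rw [hdec]
  refine ((1 - cellProj Ω R k).le_of_opNorm_le (norm_one_sub_cellProj_le Ω R k) _).trans ?_
  rw [one_mul, Lp.norm_def]
  refine ENNReal.toReal_le_of_le_ofReal hε.le ?_
  rw [eLpNorm_congr_ae (Lp.coeFn_sub _ _)]
  have : (h : ℂ → ℂ) - (stepVec Ω R k g : ℂ → ℂ) =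
      (fun z => h z - g z) + fun z => g z - stepVec Ω R k g z := by
    funext z
    simp
  rw [this]
  refine (eLpNorm_add_le
    ((Lp.aestronglyMeasurable h).sub hg.aestronglyMeasurable)
    (hg.aestronglyMeasurable.sub (Lp.aestronglyMeasurable _)) (by norm_num)).trans ?_
  refine (add_le_add hclose (hM R hR k hk)).trans_eq ?_
  rw [← ENNReal.ofReal_add (by positivity) (by positivity), add_halves]

/-- The averages of `(n + 1) ^ 3` dyadic projections on `[-n, n)²` form a quasicentral unit: the
number of levels outgrows the area `4 n²` of the box. -/
lemma isQuasicentralUnit_avgProj (hΩ : MeasurableSet Ω) :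
    IsQuasicentralUnit fun n => avgProj Ω n n ((n + 1) ^ 3) where
  compact n := isCompactOperator_avgProj Ω _ _ _
  norm_le n := norm_inv_smul_sum_le (by positivity) _ fun j _ => norm_cellProj_le Ω _ _
  norm_one_sub_le n := by
    rw [one_sub_avgProj Ω (by positivity)]
    exact norm_inv_smul_sum_le (by positivity) _ fun j _ => norm_one_sub_cellProj_le Ω _ _
  tendsto h := by
    rw [Metric.tendsto_atTop]
    intro ε hε
    obtain ⟨M, hM⟩ := exists_norm_one_sub_cellProj_apply_le hΩ h (half_pos hε)
    refine ⟨M, fun n hn => ?_⟩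
    rw [dist_comm, dist_eq_norm]
    refine lt_of_le_of_lt ?_ (half_lt_self hε)
    exact norm_one_sub_avgProj_apply_le Ω (by positivity) h fun j _ => hM n hn _ (by omega)
  tendsto_lipNorm := by
    have hb : ∀ n : ℕ, lipNorm (avgProj Ω n n ((n + 1) ^ 3)) ≤
        (32 * ((n + 1 : ℕ) : ℝ≥0∞)⁻¹) ^ (1 / 2 : ℝ) := by
      intro n
      refine iSup₂_le fun f hf => ?_
      have h1 := hsNorm_comm_avgProj_sq_le Ω n n ((n + 1) ^ 3) hf
      have h2 : (((n + 1) ^ 3 : ℕ) : ℝ≥0∞)⁻¹ ^ 2 * (32 * n ^ 2 * ((n + 1) ^ 3 : ℕ)) ≤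
          32 * ((n + 1 : ℕ) : ℝ≥0∞)⁻¹ := by
        set x : ℝ≥0∞ := ((n + 1 : ℕ) : ℝ≥0∞)
        have hx : x⁻¹ * x = 1 := ENNReal.inv_mul_cancel (by simp [x]) (ENNReal.natCast_ne_top _)
        have hn : (n : ℝ≥0∞) ≤ x := by
          simp only [x]
          exact_mod_cast n.le_succ
        rw [Nat.cast_pow, ENNReal.inv_pow]
        calc _ ≤ (x⁻¹ ^ 3) ^ 2 * (32 * x ^ 2 * x ^ 3) := by gcongr
          _ = 32 * x⁻¹ * (x⁻¹ * x) ^ 5 := by ring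
          _ = _ := by rw [hx, one_pow, mul_one]
      have h3 := ENNReal.rpow_le_rpow (h1.trans h2) (show (0 : ℝ) ≤ 1 / 2 by norm_num)
      rw [← ENNReal.rpow_natCast, ← ENNReal.rpow_mul] at h3
      simpa using h3
    refine tendsto_of_tendsto_of_tendsto_of_le_of_le tendsto_const_nhds ?_ (fun _ => zero_le) hb
    have h1 : Tendsto (fun n : ℕ => 32 * ((n + 1 : ℕ) : ℝ≥0∞)⁻¹) atTop (𝓝 0) := by
      have := ENNReal.Tendsto.const_mul (a := 32)
        ((tendsto_add_atTop_iff_nat 1).2 ENNReal.tendsto_inv_nat_nhds_zero) (Or.inr (by simp))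
      simpa using this
    have h2 := ((ENNReal.continuous_rpow_const (y := 1 / 2)).tendsto 0).comp h1
    rw [ENNReal.zero_rpow_of_pos (by norm_num)] at h2
    exact h2
  hasKernel n := by
    choose w hw _ using fun j => exists_hasKernel_cellProj Ω n (n + j)
    exact ⟨_, (HasKernel.sum _ fun j _ => hw j).smul _⟩

end StrongConvergence

/-! ### Completeness of `EΛ(Ω)` -/

section Completeness

variable {Ω : Set ℂ}

/-- `L` is lower semicontinuous for the operator norm. -/
lemma lipNorm_le_of_tendsto {T : L2 Ω →L[ℂ] L2 Ω} {Tn : ℕ → L2 Ω →L[ℂ] L2 Ω} {c : ℝ≥0∞}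
    (hT : Tendsto Tn atTop (𝓝 T)) (hc : ∀ᶠ n in atTop, lipNorm (Tn n) ≤ c) : lipNorm T ≤ c := by
  refine iSup₂_le fun f hf => ?_
  refine hsNorm_le_of_tendsto (Sn := fun n => comm f (Tn n)) (fun x => ?_)
    (hc.mono fun n hn => (le_lipNorm hf _).trans hn)
  have h : Tendsto (fun n => comm f (Tn n)) atTop (𝓝 (comm f T)) :=
    (hT.const_mul _).sub (hT.mul_const _)
  exact ((ContinuousLinearMap.apply ℂ (L2 Ω) x).continuous.tendsto _).comp h

lemma lipNorm_toB_le (x : EAlg Ω) : lipNorm (toB Ω x) ≤ ENNReal.ofReal ‖x‖ := by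
  rw [← ENNReal.ofReal_toReal (lipNorm_toB_lt_top x).ne, norm_def]
  exact ENNReal.ofReal_le_ofReal (le_add_of_nonneg_left (norm_nonneg _))

instance : CompleteSpace (EAlg Ω) := by
  refine Metric.complete_of_cauchySeq_tendsto fun u hu => ?_
  have huB : CauchySeq fun n => toB Ω (u n) :=
    (AddMonoidHomClass.uniformContinuous_of_bound (toB Ω) 1
      fun x => by simpa using norm_toB_le x).comp_cauchySeq hu
  obtain ⟨T, hT⟩ := cauchySeq_tendsto_of_complete huB
  have key : ∀ ε > 0, ∃ N, ∀ n ≥ N, lipNorm (toB Ω (u n) - T) ≤ ENNReal.ofReal ε := by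
    intro ε hε
    obtain ⟨N, hN⟩ := Metric.cauchySeq_iff.1 hu ε hε
    refine ⟨N, fun n hn => lipNorm_le_of_tendsto (tendsto_const_nhds.sub hT) ?_⟩
    filter_upwards [eventually_ge_atTop N] with m hm
    rw [← map_sub]
    refine (lipNorm_toB_le _).trans (ENNReal.ofReal_le_ofReal ?_)
    rw [← dist_eq_norm]
    exact (hN n hn m hm).le
  have hTmem : lipNorm T < ∞ := by
    obtain ⟨N, hN⟩ := key 1 one_pos
    have h := lipNorm_add_le (-(toB Ω (u N) - T)) (toB Ω (u N))
    rw [neg_sub, sub_add_cancel, ← neg_sub, lipNorm_neg] at h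
    exact h.trans_lt (ENNReal.add_lt_top.2
      ⟨(hN N le_rfl).trans_lt ENNReal.ofReal_lt_top, lipNorm_toB_lt_top _⟩)
  let t : EAlg Ω := ⟨T, hTmem⟩
  refine ⟨t, Metric.tendsto_atTop.2 fun ε hε => ?_⟩
  obtain ⟨N, hN⟩ := key (ε / 2) (by positivity)
  obtain ⟨M, hM⟩ := Metric.tendsto_atTop.1 hT (ε / 2) (by positivity)
  refine ⟨max N M, fun n hn => ?_⟩
  have h1 := hM n (le_of_max_le_right hn)
  have h2 := ENNReal.toReal_le_of_le_ofReal (by positivity) (hN n (le_of_max_le_left hn))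
  rw [dist_eq_norm] at h1
  have h3 : toB Ω (u n - t) = toB Ω (u n) - T := map_sub _ _ _
  rw [dist_eq_norm, norm_def, h3]
  linarith

instance : CompleteSpace (Corona Ω) :=
  inferInstanceAs (CompleteSpace (EAlg Ω ⧸ (kLambda Ω)))

end Completeness

/-! ### The corona inside the Calkin algebra -/

section Corona

variable {Ω : Set ℂ} {A : ℕ → L2 Ω →L[ℂ] L2 Ω} (hA : IsQuasicentralUnit A)
include hA

/-- Upper bound for `‖(1 - A n) * T‖` by the norm in the Calkin algebra: a compact perturbation of
`T` of almost minimal norm is not seen by `1 - A n` in the limit. -/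
lemma IsQuasicentralUnit.norm_one_sub_mul_le (T : L2 Ω →L[ℂ] L2 Ω) {ε : ℝ} (hε : 0 < ε) :
    ∀ᶠ n in atTop, ‖(1 - A n) * T‖ ≤ ‖Ideal.Quotient.mk (compactIdeal (L2 Ω)) T‖ + ε := by
  obtain ⟨a, ha, hn⟩ := Submodule.Quotient.norm_mk_lt
    (Ideal.Quotient.mk (compactIdeal (L2 Ω)) T) (half_pos hε)
  have hK : IsCompactOperator (T - a : L2 Ω →L[ℂ] L2 Ω) := Ideal.Quotient.eq.1 ha.symm
  have hlim := tendsto_norm_mul_of_isCompactOperator hA.norm_one_sub_le hA.one_sub_tendsto hK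
  filter_upwards [hlim.eventually_lt_const (half_pos hε)] with n h
  have h1 : (1 - A n) * T = (1 - A n) * a + (1 - A n) * (T - a) := by noncomm_ring
  have h2 : ‖(1 - A n) * a‖ ≤ ‖a‖ :=
    (norm_mul_le _ _).trans (mul_le_of_le_one_left (norm_nonneg _) (hA.norm_one_sub_le n))
  rw [h1]
  linarith [norm_add_le ((1 - A n) * a) ((1 - A n) * (T - a))]

/-- The `C*`-inequality in the Calkin algebra. -/
lemma IsQuasicentralUnit.norm_mul_self_le_calkin (T : L2 Ω →L[ℂ] L2 Ω) :
    ‖Ideal.Quotient.mk (compactIdeal (L2 Ω)) T‖ * ‖Ideal.Quotient.mk (compactIdeal (L2 Ω)) T‖ ≤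
      ‖Ideal.Quotient.mk (compactIdeal (L2 Ω)) (star T * T)‖ := by
  refine le_of_forall_pos_le_add fun ε hε => ?_
  obtain ⟨n, hn⟩ := (hA.norm_one_sub_mul_le (star T * T) hε).exists
  refine le_trans ?_ hn
  -- The compact operator is removed on the right of `T`, so that `1 - A n` stands on the left of
  -- `T* T`.
  have h1 : Ideal.Quotient.mk (compactIdeal (L2 Ω)) T =
      Ideal.Quotient.mk (compactIdeal (L2 Ω)) (T * star (1 - A n)) := by
    rw [Ideal.Quotient.eq, star_sub, star_one, mul_sub, mul_one, sub_sub_cancel]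
    exact Ideal.mul_mem_left _ _ (isCompactOperator_star (hA.compact n))
  have h2 : ‖Ideal.Quotient.mk (compactIdeal (L2 Ω)) T‖ ≤ ‖T * star (1 - A n)‖ := by
    rw [h1]
    exact Submodule.Quotient.norm_mk_le _ _
  calc _ ≤ ‖T * star (1 - A n)‖ * ‖T * star (1 - A n)‖ := by gcongr
    _ = ‖((1 - A n) * (star T * T)) * star (1 - A n)‖ := by
        rw [← CStarRing.norm_star_mul_self, star_mul, star_star]
        simp only [mul_assoc]
    _ ≤ ‖(1 - A n) * (star T * T)‖ * ‖star (1 - A n)‖ := norm_mul_le _ _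
    _ ≤ ‖(1 - A n) * (star T * T)‖ := by
        refine mul_le_of_le_one_right (norm_nonneg _) ?_
        exact (norm_star (1 - A n)).trans_le (hA.norm_one_sub_le n)

lemma IsQuasicentralUnit.norm_mk_eq (x : EAlg Ω) :
    ‖Ideal.Quotient.mk (kLambda Ω) x‖ = ‖Ideal.Quotient.mk (compactIdeal (L2 Ω)) (toB Ω x)‖ := by
  refine le_antisymm (le_of_forall_pos_le_add fun ε hε => ?_)
    (le_of_forall_pos_le_add fun ε hε => ?_)
  · have hlim := (ENNReal.tendsto_toReal ENNReal.zero_ne_top).comp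
      (hA.tendsto_lipNorm_one_sub_mul (lipNorm_toB_lt_top x))
    obtain ⟨n, h1, h2, h3⟩ := ((hA.norm_one_sub_mul_le (toB Ω x) (half_pos hε)).and
      ((hlim.eventually_lt_const (half_pos hε)).and
        (hA.tendsto_lipNorm.eventually_lt_const ENNReal.zero_lt_top))).exists
    let a : EAlg Ω := ⟨A n, h3⟩
    have h4 : Ideal.Quotient.mk (kLambda Ω) x = Ideal.Quotient.mk (kLambda Ω) (x - a * x) := by
      rw [Ideal.Quotient.eq, sub_sub_cancel]
      exact Ideal.mul_mem_right _ _ (hA.compact n)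
    have h5 : toB Ω (x - a * x) = (1 - A n) * toB Ω x := by
      rw [map_sub, map_mul, sub_mul, one_mul]
      rfl
    rw [h4]
    refine (Submodule.Quotient.norm_mk_le _ _).trans ?_
    rw [norm_def, h5]
    simp only [Function.comp] at h2
    linarith
  · obtain ⟨y, hy, hn⟩ := Submodule.Quotient.norm_mk_lt (Ideal.Quotient.mk (kLambda Ω) x) hε
    have h1 : Ideal.Quotient.mk (compactIdeal (L2 Ω)) (toB Ω x) =
        Ideal.Quotient.mk (compactIdeal (L2 Ω)) (toB Ω y) := by
      rw [Ideal.Quotient.eq, ← map_sub]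
      exact (Ideal.Quotient.eq (I := kLambda Ω)).1 hy.symm
    rw [h1]
    exact ((Submodule.Quotient.norm_mk_le _ _).trans (norm_toB_le y)).trans hn.le

omit hA
variable (Ω)

/-- The `*`-homomorphism `EΛ(Ω) → ℬ/𝒦`, `x ↦ x + 𝒦`. -/
def toCalkin : EAlg Ω →⋆ₐ[ℂ] Calkin (L2 Ω) where
  toAlgHom := (Ideal.Quotient.mkₐ ℂ (compactIdeal (L2 Ω))).comp (toB Ω).toAlgHom
  map_star' := fun x => by
    change Ideal.Quotient.mk (compactIdeal (L2 Ω)) (toB Ω (star x)) = _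
    rw [map_star]
    rfl

/-- The `*`-homomorphism `(E/𝒦)Λ(Ω) → ℬ/𝒦`, `p(x) ↦ x + 𝒦`. -/
def coronaToCalkin : Corona Ω →⋆ₐ[ℂ] Calkin (L2 Ω) where
  toAlgHom := Ideal.Quotient.liftₐ (kLambda Ω) (toCalkin Ω).toAlgHom fun _ hx =>
    Ideal.Quotient.eq_zero_iff_mem.2 (mem_kLambda.1 hx)
  map_star' := by
    rintro ⟨x⟩
    exact map_star (toCalkin Ω) x

lemma coronaToCalkin_mk (x : EAlg Ω) : coronaToCalkin Ω (Ideal.Quotient.mk (kLambda Ω) x) =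
    Ideal.Quotient.mk (compactIdeal (L2 Ω)) (toB Ω x) := rfl

include hA

lemma IsQuasicentralUnit.isometry_coronaToCalkin : Isometry (coronaToCalkin Ω) := by
  refine AddMonoidHomClass.isometry_of_norm _ ?_
  intro x
  obtain ⟨x, rfl⟩ := Ideal.Quotient.mk_surjective x
  rw [coronaToCalkin_mk, hA.norm_mk_eq]

lemma IsQuasicentralUnit.cStarRing_corona : CStarRing (Corona Ω) where
  norm_mul_self_le := fun x => by
    obtain ⟨x, rfl⟩ := Ideal.Quotient.mk_surjective x
    rw [star_mk, ← map_mul, hA.norm_mk_eq, hA.norm_mk_eq, map_mul (toB Ω), map_star (toB Ω)]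
    exact hA.norm_mul_self_le_calkin (toB Ω x)

end Corona

end ELam
end

theorem mainTheorem4 (Ω : Set ℂ) (hΩ : MeasurableSet Ω) :
    (CompleteSpace (ELam.Corona Ω) ∧ CStarRing (ELam.Corona Ω)) ∧
    (∀ x : ELam.EAlg Ω,
      ‖Ideal.Quotient.mk (ELam.kLambda Ω) x‖ =
        ‖Ideal.Quotient.mk (ELam.compactIdeal (ELam.L2 Ω)) (ELam.toB Ω x)‖) ∧
    (∃ S : StarSubalgebra ℂ (ELam.Calkin (ELam.L2 Ω)),
      IsClosed (S : Set (ELam.Calkin (ELam.L2 Ω))) ∧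
      ∃ e : ELam.Corona Ω ≃⋆ₐ[ℂ] S, Isometry e ∧
        ∀ x : ELam.EAlg Ω,
          (e (Ideal.Quotient.mk (ELam.kLambda Ω) x) : ELam.Calkin (ELam.L2 Ω)) =
            Ideal.Quotient.mk (ELam.compactIdeal (ELam.L2 Ω)) (ELam.toB Ω x)) := by
  have hA := ELam.isQuasicentralUnit_avgProj hΩ
  have hiso := hA.isometry_coronaToCalkin
  refine ⟨⟨inferInstance, hA.cStarRing_corona⟩, hA.norm_mk_eq,
    (ELam.coronaToCalkin Ω).range, ?_, StarAlgEquiv.ofInjective _ hiso.injective, ?_, ?_⟩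
  · exact hiso.isClosedEmbedding.isClosed_range
  · exact hiso
  · exact ELam.coronaToCalkin_mk Ω
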